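/- Let $(E,\mathscr E,\mu)$ be a measure space with $\mu$ $\sigma$-finite, let $1\le p<\infty$, and let $X=L^p(E,\mu)$ be the space of real-valued $p$-integrable functions (a weighted space $L^p_m(E,\mu)$ with measurable weight $m:E\to(0,\infty)$ and norm $\|mf\|_{L^p(\mu)}$ is the space $L^p(E,m^p\mu)$, so it is included). Let $X'$ be the dual space of $X$, identified with $L^q(E,\mu)$, $\frac1p+\frac1q=1$, through $\langle\phi,f\rangle=\int_E\phi f\,d\mu$, and let $X_{\mathbb C}$ be the space of complex-valued functions $f$ with $|f|\in X$. Write $X_+$ for the set of almost everywhere nonnegative functions of $X$, and $X_{++}$, $X'_{++}$ for the sets of almost everywhere strictly positive functions of $X$ and $X'$. A bounded operator $U$ on $X$ is extended to $X_{\mathbb C}$ by $U(g+ih)=Ug+iUh$; its spectrum, its eigenvalues and its spectral radius $r(U)$ are those of this extension. An operator is called power compact if one of its powers of exponent $\ell\ge1$ is compact. For an operator $A$, $N(A)$ denotes its null space. **Theorem.** Let $U$ be a bounded operator on $X$ such that $Uf\in X_{++}$ for every $f\in X_+\setminus\{0\}$. Assume that there are bounded operators $W,K$ on $X$ with $$U=W+K,\qquad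 \|W\|<r(U),\qquad K(\lambda-W)^{-1}\ \text{power compact on } X_{\mathbb C} \text{ for every } \lambda\in\mathbb C \text{ with } |\lambda|>\|W\|,$$ and set $\widetilde U=U/r(U)$. Then there exist $f_0\in X_{++}$ and $\phi_0\in X'_{++}$ such that: 1. $\widetilde Uf_0=f_0$ and $\widetilde U^*\phi_0=\phi_0$; 2. $N(\widetilde U-I)=\operatorname{Span}(f_0)$ and $N(\widetilde U^*-I)=\operatorname{Span}(\phi_0)$; 3. the peripheral point spectrum of $\widetilde U$, that is, the set of eigenvalues of $\widetilde U$ of modulus $r(\widetilde U)=1$, is equal to $\{1\}$; 4. there exist $\zeta\in(0,1)$ and $C\ge1$ such that $\|\widetilde U^nf\|\le C\,\zeta^n\,\|f\|$ for all $n\in\mathbb N$ and all $f\in X$ with $\langle\phi_0,f\rangle=0$. -/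

import Mathlib

open MeasureTheory

namespace LpOperator

noncomputable section

variable {E : Type*} [MeasurableSpace E] {μ : Measure E} {p : ENNReal}

/-- `f ≫ 0`: the function `f` is strictly positive almost everywhere. -/
def StrictlyPos (f : Lp ℝ p μ) : Prop := ∀ᵐ x ∂μ, 0 < f x

variable [Fact (1 ≤ p)]

/-- `U : X₊ \ {0} → X₊₊`: the operator `U` sends every nonzero (almost everywhere) nonnegative
function to an almost everywhere strictly positive function. -/
def IsStrictlyPositiveOp (U : Lp ℝ p μ →L[ℝ] Lp ℝ p μ) : Prop :=
  ∀ f : Lp ℝ p μ, 0 ≤ f → f ≠ 0 → StrictlyPos (U f)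

/-- `φ ∈ X'₊₊`: the functional `φ` on `X = L^p` is given by integration against an almost
everywhere strictly positive function of `L^q`, where `q` is the conjugate exponent of `p`. -/
def StrictlyPosDual (φ : StrongDual ℝ (Lp ℝ p μ)) : Prop :=
  ∃ g : Lp ℝ p.conjExponent μ, StrictlyPos g ∧ ∀ f : Lp ℝ p μ, φ f = ∫ x, g x * f x ∂μ

/-- The dual operator `U* : X' → X'`, `⟨U* φ, f⟩ = ⟨φ, U f⟩`. -/
def dualOp (U : Lp ℝ p μ →L[ℝ] Lp ℝ p μ) :
    StrongDual ℝ (Lp ℝ p μ) →L[ℝ] StrongDual ℝ (Lp ℝ p μ) :=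
  ContinuousLinearMap.precomp ℝ U

theorem dualOp_apply (U : Lp ℝ p μ →L[ℝ] Lp ℝ p μ) (φ : StrongDual ℝ (Lp ℝ p μ))
    (f : Lp ℝ p μ) : dualOp U φ f = φ (U f) := rfl

/-- Real part `X_ℂ → X`. -/
def reL : Lp ℂ p μ →L[ℝ] Lp ℝ p μ := Complex.reCLM.compLpL p μ

/-- Imaginary part `X_ℂ → X`. -/
def imL : Lp ℂ p μ →L[ℝ] Lp ℝ p μ := Complex.imCLM.compLpL p μ

/-- Inclusion `X → X_ℂ`. -/
def ofRealL : Lp ℝ p μ →L[ℝ] Lp ℂ p μ := Complex.ofRealCLM.compLpL p μ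

theorem reL_I_smul (f : Lp ℂ p μ) : reL (Complex.I • f) = -imL f := by
  refine Lp.ext ?_
  filter_upwards [Complex.reCLM.coeFn_compLpL (p := p) (Complex.I • f),
    Complex.imCLM.coeFn_compLpL (p := p) f, Lp.coeFn_smul Complex.I f,
    Lp.coeFn_neg (imL f)] with x h1 h2 h3 h4
  rw [h4]
  simp only [Pi.neg_apply, reL, imL] at *
  rw [h1, h2, h3]
  simp

theorem imL_I_smul (f : Lp ℂ p μ) : imL (Complex.I • f) = reL f := by
  refine Lp.ext ?_
  filter_upwards [Complex.imCLM.coeFn_compLpL (p := p) (Complex.I • f),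
    Complex.reCLM.coeFn_compLpL (p := p) f, Lp.coeFn_smul Complex.I f] with x h1 h2 h3
  simp only [reL, imL] at *
  rw [h1, h2, h3]
  simp

/-- The underlying real-linear map of the complexification, `g + i h ↦ U g + i U h`. -/
def complexifyAux (U : Lp ℝ p μ →L[ℝ] Lp ℝ p μ) : Lp ℂ p μ →L[ℝ] Lp ℂ p μ :=
  ofRealL ∘L U ∘L reL + Complex.I • (ofRealL ∘L U ∘L imL)

theorem complexifyAux_apply (U : Lp ℝ p μ →L[ℝ] Lp ℝ p μ) (f : Lp ℂ p μ) :
    complexifyAux U f = ofRealL (U (reL f)) + Complex.I • ofRealL (U (imL f)) := rfl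

theorem complexifyAux_I_smul (U : Lp ℝ p μ →L[ℝ] Lp ℝ p μ) (f : Lp ℂ p μ) :
    complexifyAux U (Complex.I • f) = Complex.I • complexifyAux U f := by
  simp only [complexifyAux_apply, reL_I_smul, imL_I_smul, map_neg, smul_add, smul_smul,
    Complex.I_mul_I, neg_smul, one_smul]
  abel

theorem complexifyAux_smul (U : Lp ℝ p μ →L[ℝ] Lp ℝ p μ) (c : ℂ) (f : Lp ℂ p μ) :
    complexifyAux U (c • f) = c • complexifyAux U f := by
  have key : ∀ g : Lp ℂ p μ, c • g = c.re • g + c.im • (Complex.I • g) := by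
    intro g
    conv_lhs => rw [← Complex.re_add_im c]
    rw [add_smul, mul_smul]
    rfl
  rw [key f, key (complexifyAux U f), map_add, map_smul, map_smul, complexifyAux_I_smul]

/-- The operator `U` extended to the complex space `X_ℂ` by `U (g + i h) = U g + i U h`. -/
def complexify (U : Lp ℝ p μ →L[ℝ] Lp ℝ p μ) : Lp ℂ p μ →L[ℂ] Lp ℂ p μ where
  toFun := complexifyAux U
  map_add' := map_add _
  map_smul' := complexifyAux_smul U
  cont := (complexifyAux U).cont

theorem complexify_apply (U : Lp ℝ p μ →L[ℝ] Lp ℝ p μ) (f : Lp ℂ p μ) :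
    complexify U f = ofRealL (U (reL f)) + Complex.I • ofRealL (U (imL f)) := rfl

/-- The spectral radius `r(U)` of a bounded operator on `X`, its spectrum being that of its
complexification. -/
def specRad (U : Lp ℝ p μ →L[ℝ] Lp ℝ p μ) : ℝ := (spectralRadius ℂ (complexify U)).toReal

/-- The normalized operator `Ũ = U / r(U)`. -/
def normalized (U : Lp ℝ p μ →L[ℝ] Lp ℝ p μ) : Lp ℝ p μ →L[ℝ] Lp ℝ p μ :=
  (specRad U)⁻¹ • U

/-- Some power `A ^ l`, `l ≥ 1`, of the operator is compact. -/
def IsPowerCompact (A : Lp ℂ p μ →L[ℂ] Lp ℂ p μ) : Prop :=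
  ∃ l : ℕ, 1 ≤ l ∧ IsCompactOperator (A ^ l)

/-- `U = W + K` with `‖W‖ < r(U)` and `K (z - W)⁻¹` power compact on `X_ℂ` for every complex
number `z` with `|z| > ‖W‖` (for such `z` the operator `z - W` is invertible). -/
def AdmitsSplitting (U : Lp ℝ p μ →L[ℝ] Lp ℝ p μ) : Prop :=
  ∃ W K : Lp ℝ p μ →L[ℝ] Lp ℝ p μ, U = W + K ∧ ‖W‖ < specRad U ∧
    ∀ z : ℂ, ‖W‖ < ‖z‖ → IsPowerCompact (complexify K ∘L resolvent (complexify W) z)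

/-- The set of (complex) eigenvalues of `U` whose modulus is equal to `r(U)`. -/
def peripheralPointSpectrum (U : Lp ℝ p μ →L[ℝ] Lp ℝ p μ) : Set ℂ :=
  {z | (∃ f : Lp ℂ p μ, f ≠ 0 ∧ complexify U f = z • f) ∧ ‖z‖ = specRad U}

end

end LpOperator

open LpOperator

/-! Write V = U/r(U), an operator of spectral radius one. The splitting gives z - V = (1 - T)S with
S invertible and T power compact for |z| ≥ 1. This replaces Fredholm theory: since 1 - T^l is a
multiple of 1 - T, bounded approximate null vectors of z - V converge along ultrafilters
(`EssInvertible.exists_tendsto`), with a counterpart for functionals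
(`EssInvertible.tendsto_functional`).

Existence is of Krein-Rutman type. The resolvent R(s) of V is positive for s > 1, and ‖R(s)‖(s - 1)
≥ 1; otherwise a positive resolvent would exist at some t < 1, and it would dominate the powers of V
and push the spectral radius below one. Normalized vectors R(s)|x| are then nonnegative approximate
fixed vectors, whose limit is f₀. Normalized functionals φ ∘ R(s) have a weak-* limit, invariant
under V and nonzero by compactness. The Riesz representation turns it into an L^q density, and
strict positivity of V makes both f₀ and this density positive almost everywhere.

Everything else follows from one inequality, `IsPerronPair.apply_abs_lt`: if φ(a) = 0 and a ≠ 0,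
then V a⁺ and V a⁻ overlap and cancel, so φ|Va| < φ|a|. It excludes further fixed vectors and, by
maximizing φ|Re(wf)| over the unit circle, eigenvalues z ≠ 1 of modulus one. Hence V - φ ⊗ f₀, still
essentially invertible after subtraction from z, has no eigenvalue with |z| ≥ 1 and so has spectral
radius below one. On ker φ its powers are those of V, which gives the decay; the decay in turn makes
every invariant functional a multiple of φ. -/

open Filter Topology

namespace LpOperator

/-! ### Compactness substitutes for Fredholm theory. -/

section EssInvertible

variable {𝕜 Z : Type*} [NontriviallyNormedField 𝕜] [NormedAddCommGroup Z] [NormedSpace 𝕜 Z]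

/-- `D` factors as `(1 - T) S` with `S` invertible and `T` power compact. -/
def EssInvertible (D : Z →L[𝕜] Z) : Prop :=
  ∃ (S T : Z →L[𝕜] Z) (l : ℕ), IsUnit S ∧ IsCompactOperator (T ^ l) ∧ D = (1 - T) * S

/-- Modulo the two-sided ideal of compact operators, T + F and T have the same powers. -/
theorem isCompactOperator_pow_add {T F : Z →L[𝕜] Z} {l : ℕ} (hT : IsCompactOperator (T ^ l))
    (hF : IsCompactOperator F) : IsCompactOperator ((T + F) ^ l) := by
  have key : ∀ n : ℕ, IsCompactOperator ((T + F) ^ n - T ^ n) := by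
    intro n
    induction n with
    | zero => simpa using isCompactOperator_zero (M₁ := Z) (M₂ := Z)
    | succ n ih =>
      have h : (T + F) ^ (n + 1) - T ^ (n + 1) =
          ((T + F) ^ n - T ^ n) * (T + F) + T ^ n * F := by
        rw [pow_succ, pow_succ]; noncomm_ring
      rw [h]
      exact (ih.comp_clm (T + F)).add (hF.clm_comp (T ^ n))
  have h : (T + F) ^ l = ((T + F) ^ l - T ^ l) + T ^ l := by abel
  rw [h]
  exact (key l).add hT

/-- The perturbation is absorbed into T: (1 - T)S + F = (1 - (T - F S⁻¹))S. This is what allows a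
rank-one deflation. -/
theorem EssInvertible.add_compact {D F : Z →L[𝕜] Z} (hD : EssInvertible D)
    (hF : IsCompactOperator F) : EssInvertible (D + F) := by
  obtain ⟨S, T, l, ⟨S, rfl⟩, hT, rfl⟩ := hD
  refine ⟨S, T + (-F) * (↑S⁻¹ : Z →L[𝕜] Z), l, S.isUnit,
    isCompactOperator_pow_add hT (hF.neg.comp_clm _), ?_⟩
  have : (-F) * (↑S⁻¹ : Z →L[𝕜] Z) * S = -F := by rw [mul_assoc]; simp
  rw [sub_mul, sub_mul, add_mul, this]
  abel

theorem EssInvertible.smul {D : Z →L[𝕜] Z} (hD : EssInvertible D) {c : 𝕜} (hc : c ≠ 0) :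
    EssInvertible (c • D) := by
  obtain ⟨S, T, l, hS, hT, rfl⟩ := hD
  exact ⟨c • S, T, l, hS.smul (Units.mk0 c hc), hT, by rw [mul_smul_comm]⟩

/-- The factorization used to compare a power compact operator `T` with `1 - T`. -/
theorem one_sub_pow_eq (T : Z →L[𝕜] Z) (l : ℕ) :
    ∃ Q : Z →L[𝕜] Z, 1 - T ^ l = Q * (1 - T) ∧ 1 - T ^ l = (1 - T) * Q :=
  ⟨∑ i ∈ Finset.range l, T ^ i, (geom_sum_mul_neg T l).symm, (mul_neg_geom_sum T l).symm⟩

theorem exists_tendsto_of_isCompactOperator {ι : Type*} {A : Z →L[𝕜] Z}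
    (hA : IsCompactOperator A) (𝓤 : Ultrafilter ι) {v : ι → Z} {C : ℝ} (hv : ∀ i, ‖v i‖ ≤ C) :
    ∃ y, Tendsto (fun i => A (v i)) 𝓤 (𝓝 y) := by
  obtain ⟨K, hK, hsub⟩ := hA.image_closedBall_subset_compact (f := (A : Z →ₗ[𝕜] Z)) C
  have hmem : ((𝓤.map fun i => A (v i) : Ultrafilter Z) : Filter Z) ≤ 𝓟 K := by
    rw [le_principal_iff]
    refine Filter.mem_map.2 (Filter.univ_mem' fun i => hsub ⟨v i, ?_, rfl⟩)
    simpa using hv i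
  obtain ⟨y, -, hy⟩ := isCompact_iff_ultrafilter_le_nhds.1 hK _ hmem
  exact ⟨y, hy⟩

/-- Bounded approximate null vectors of an essentially invertible operator converge along
ultrafilters. -/
theorem EssInvertible.exists_tendsto {D : Z →L[𝕜] Z} (hD : EssInvertible D) {ι : Type*}
    (𝓤 : Ultrafilter ι) {u : ι → Z} {C : ℝ} (hu : ∀ i, ‖u i‖ ≤ C)
    (h : Tendsto (fun i => D (u i)) 𝓤 (𝓝 0)) : ∃ y, Tendsto u 𝓤 (𝓝 y) := by
  obtain ⟨S, T, l, ⟨S, rfl⟩, hT, rfl⟩ := hD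
  obtain ⟨Q, hQ, -⟩ := one_sub_pow_eq T l
  have hv : ∀ i, ‖(S : Z →L[𝕜] Z) (u i)‖ ≤ ‖(S : Z →L[𝕜] Z)‖ * C := fun i =>
    (ContinuousLinearMap.le_opNorm _ _).trans (by gcongr; exact hu i)
  obtain ⟨y, hy⟩ := exists_tendsto_of_isCompactOperator hT 𝓤 hv
  have h1 : Tendsto (fun i => Q (((1 - T) * (S : Z →L[𝕜] Z)) (u i))) 𝓤 (𝓝 0) := by
    have := (Q.continuous.tendsto 0).comp h
    rwa [map_zero] at this
  -- S u = Q(1 - T)S u + T^l S u: the first term tends to zero, the second converges by compactness.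
  have h2 : Tendsto (fun i => (S : Z →L[𝕜] Z) (u i)) 𝓤 (𝓝 y) := by
    have h3 := h1.add hy
    rw [zero_add] at h3
    refine h3.congr fun i => ?_
    have h4 := congrArg (fun A : Z →L[𝕜] Z => A ((S : Z →L[𝕜] Z) (u i))) hQ
    simp only [sub_apply, mul_apply_eq_comp,
      one_apply_eq_self] at h4 ⊢
    rw [← h4]; abel
  refine ⟨(↑S⁻¹ : Z →L[𝕜] Z) y, ?_⟩
  refine (((↑S⁻¹ : Z →L[𝕜] Z).continuous.tendsto y).comp h2).congr fun i => ?_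
  have : ((↑S⁻¹ : Z →L[𝕜] Z) * (S : Z →L[𝕜] Z)) (u i) = u i := by simp
  exact this

/-- A bounded sequence of functionals which asymptotically annihilates the range of an essentially
invertible operator and tends to zero pointwise tends to zero uniformly on bounded sets. -/
theorem EssInvertible.tendsto_functional {D : Z →L[𝕜] Z} (hD : EssInvertible D) {ι : Type*}
    (𝓤 : Ultrafilter ι) {Ψ : ι → Z →+ ℝ} {C : ℝ} (hΨ : ∀ i x, |Ψ i x| ≤ C * ‖x‖)
    {ε : ι → ℝ} (hε : Tendsto ε 𝓤 (𝓝 0)) (h : ∀ i x, |Ψ i (D x)| ≤ ε i * ‖x‖)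
    (h0 : ∀ x, Tendsto (fun i => Ψ i x) 𝓤 (𝓝 0)) {x : ι → Z} {M : ℝ} (hx : ∀ i, ‖x i‖ ≤ M) :
    Tendsto (fun i => Ψ i (x i)) 𝓤 (𝓝 0) := by
  obtain ⟨S, T, l, ⟨S, rfl⟩, hT, rfl⟩ := hD
  obtain ⟨Q, -, hQ⟩ := one_sub_pow_eq T l
  obtain ⟨y, hy⟩ := exists_tendsto_of_isCompactOperator hT 𝓤 hx
  -- Here Q stands to the right of 1 - T, so that x = D(S⁻¹Q x) + T^l x. The first piece lies in the
  -- range of D; the second is close to the fixed vector y.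
  have hsplit : ∀ i, Ψ i (x i) =
      Ψ i (((1 - T) * (S : Z →L[𝕜] Z)) (((↑S⁻¹ : Z →L[𝕜] Z) * Q) (x i))) +
        (Ψ i ((T ^ l) (x i) - y) + Ψ i y) := by
    intro i
    have h1 : ((1 - T) * (S : Z →L[𝕜] Z)) * ((↑S⁻¹ : Z →L[𝕜] Z) * Q) = 1 - T ^ l := by
      rw [hQ, mul_assoc, ← mul_assoc (S : Z →L[𝕜] Z)]; simp
    rw [← mul_apply_eq_comp, h1, ← map_add, ← map_add]
    congr 1
    simp
  simp_rw [hsplit]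
  have hA : Tendsto (fun i => Ψ i (((1 - T) * (S : Z →L[𝕜] Z))
      (((↑S⁻¹ : Z →L[𝕜] Z) * Q) (x i)))) 𝓤 (𝓝 0) := by
    have hb : Tendsto (fun i => |ε i| * (‖(↑S⁻¹ : Z →L[𝕜] Z) * Q‖ * M)) 𝓤 (𝓝 0) := by
      simpa using hε.abs.mul_const (‖(↑S⁻¹ : Z →L[𝕜] Z) * Q‖ * M)
    refine squeeze_zero_norm (fun i => ?_) hb
    refine (h i _).trans ?_
    gcongr
    · exact le_abs_self _
    · exact (ContinuousLinearMap.le_opNorm _ _).trans (by gcongr; exact hx i)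
  have hB : Tendsto (fun i => Ψ i ((T ^ l) (x i) - y)) 𝓤 (𝓝 0) := by
    have hb : Tendsto (fun i => C * ‖(T ^ l) (x i) - y‖) 𝓤 (𝓝 0) := by
      have := (tendsto_iff_norm_sub_tendsto_zero.1 hy).const_mul C
      simpa using this
    exact squeeze_zero_norm (fun i => hΨ i _) hb
  simpa using hA.add (hB.add (h0 y))

end EssInvertible

/-! ### Blow-up of inverses near a non-invertible operator. -/

section ApproximateSpectrum

variable {𝕜 Z : Type*} [RCLike 𝕜] [NormedAddCommGroup Z] [NormedSpace 𝕜 Z]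

/-- An operator of norm at least `1 / ε` almost attains this bound at some vector. -/
theorem exists_norm_lt_mul_norm_apply {R : Z →L[𝕜] Z} {ε : ℝ}
    (hR : 1 ≤ ‖R‖ * ε) : ∃ x, ‖x‖ < 2 * ε * ‖R x‖ := by
  by_contra! hcon
  have hε : 0 < ε := by
    by_contra! hε
    nlinarith [norm_nonneg R]
  have : ‖R‖ ≤ (2 * ε)⁻¹ := by
    refine ContinuousLinearMap.opNorm_le_bound _ (by positivity) fun x => ?_
    have := hcon x
    rw [inv_mul_eq_div, le_div_iff₀ (by positivity)]
    linarith
  have h2 : ‖R‖ * ε ≤ (2 * ε)⁻¹ * ε := by gcongr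
  have h3 : (2 * ε)⁻¹ * ε = 1 / 2 := by field_simp
  linarith

theorem one_le_norm_inverse_mul [CompleteSpace Z] {D : Z →L[𝕜] Z} (hD : ¬ IsUnit D)
    (B : (Z →L[𝕜] Z)ˣ) : 1 ≤ ‖(↑B⁻¹ : Z →L[𝕜] Z)‖ * ‖D - B‖ := by
  by_contra! hcon
  refine hD ?_
  have h1 : ‖(↑B⁻¹ : Z →L[𝕜] Z) * (B - D)‖ < 1 :=
    (norm_mul_le _ _).trans_lt (by rwa [norm_sub_rev])
  have h2 : D = B * (1 - (↑B⁻¹ : Z →L[𝕜] Z) * (B - D)) := by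
    rw [mul_sub, ← mul_assoc]; simp
  rw [h2]
  exact B.isUnit.mul (Units.oneSub _ h1).isUnit

end ApproximateSpectrum

/-! ### Spectral radius and growth of powers. -/

section SpectralRadius

variable {Z : Type*} [NormedAddCommGroup Z] [NormedSpace ℂ Z]

theorem le_of_forall_pow_le {a b C : ℝ} (hb : 0 ≤ b) (h : ∀ n : ℕ, a ^ n ≤ C * b ^ n) :
    a ≤ b := by
  by_contra! hlt
  rcases hb.eq_or_lt with rfl | hb
  · have := h 1
    simp at this
    linarith
  · have h1 : 1 < a / b := by rwa [one_lt_div hb]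
    obtain ⟨n, hn⟩ := pow_unbounded_of_one_lt C h1
    have := h n
    rw [div_pow, lt_div_iff₀ (by positivity)] at hn
    linarith

theorem norm_le_of_mem_spectrum [CompleteSpace Z] {A : Z →L[ℂ] Z} {C t : ℝ} (ht : 0 ≤ t)
    (h : ∀ n, ‖A ^ n‖ ≤ C * t ^ n) {z : ℂ} (hz : z ∈ spectrum ℂ A) : ‖z‖ ≤ t := by
  -- Keeping the factor ‖1‖ covers the zero space, where it vanishes.
  refine le_of_forall_pow_le (C := C * ‖(1 : Z →L[ℂ] Z)‖) ht fun n => ?_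
  have h1 := spectrum.norm_le_norm_mul_of_mem (spectrum.pow_mem_pow A n hz)
  rw [norm_pow] at h1
  refine h1.trans ?_
  have := mul_le_mul_of_nonneg_right (h n) (norm_nonneg (1 : Z →L[ℂ] Z))
  linarith

theorem spectralRadius_le_of_norm_pow_le [CompleteSpace Z] {A : Z →L[ℂ] Z} {C t : ℝ} (ht : 0 ≤ t)
    (h : ∀ n, ‖A ^ n‖ ≤ C * t ^ n) : spectralRadius ℂ A ≤ ENNReal.ofReal t := by
  refine iSup₂_le fun z hz => ?_
  rw [← enorm_eq_nnnorm, ← ofReal_norm]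
  exact ENNReal.ofReal_le_ofReal (norm_le_of_mem_spectrum ht h hz)

/-- By Gelfand's formula ‖A^n‖ ≤ t^n from some index on; the constant pays for the finitely many
earlier powers. -/
theorem exists_norm_pow_le_of_spectralRadius_lt [CompleteSpace Z] (A : Z →L[ℂ] Z) {t : ℝ}
    (ht : 0 < t) (h : spectralRadius ℂ A < ENNReal.ofReal t) :
    ∃ C : ℝ, 1 ≤ C ∧ ∀ n, ‖A ^ n‖ ≤ C * t ^ n := by
  have h1 := (spectrum.pow_norm_pow_one_div_tendsto_nhds_spectralRadius A).eventually_lt_const h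
  obtain ⟨N, hN⟩ := eventually_atTop.1 (h1.and (eventually_ge_atTop 1))
  refine ⟨1 + ∑ i ∈ Finset.range N, ‖A ^ i‖ / t ^ i, ?_, fun n => ?_⟩
  · have : 0 ≤ ∑ i ∈ Finset.range N, ‖A ^ i‖ / t ^ i := Finset.sum_nonneg fun i _ => by positivity
    linarith
  · have hs : 0 ≤ ∑ i ∈ Finset.range N, ‖A ^ i‖ / t ^ i :=
      Finset.sum_nonneg fun i _ => by positivity
    rcases lt_or_ge n N with hn | hn
    · have h2 : ‖A ^ n‖ / t ^ n ≤ ∑ i ∈ Finset.range N, ‖A ^ i‖ / t ^ i :=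
        Finset.single_le_sum (f := fun i => ‖A ^ i‖ / t ^ i) (fun i _ => by positivity)
          (Finset.mem_range.2 hn)
      rw [div_le_iff₀ (by positivity)] at h2
      have : 0 < t ^ n := by positivity
      linarith
    · obtain ⟨h2, h3⟩ := hN n hn
      have h4 : ‖A ^ n‖ ^ (1 / n : ℝ) < t := (ENNReal.ofReal_lt_ofReal_iff ht).1 h2
      have h5 : ‖A ^ n‖ ≤ t ^ n := by
        have h6 := pow_le_pow_left₀ (by positivity) h4.le n
        rwa [one_div, Real.rpow_inv_natCast_pow (norm_nonneg _) (by omega)] at h6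
      have : 0 < t ^ n := by positivity
      nlinarith

/-- If `z - A` is essentially invertible for `|z| ≥ 1` and `A` has no eigenvalue in this region,
then the spectral radius of `A` is smaller than one. -/
theorem spectralRadius_lt_one_of_essInvertible [CompleteSpace Z] (A : Z →L[ℂ] Z)
    (hess : ∀ z : ℂ, 1 ≤ ‖z‖ → EssInvertible (algebraMap ℂ (Z →L[ℂ] Z) z - A))
    (heig : ∀ z : ℂ, 1 ≤ ‖z‖ → ∀ u, A u = z • u → u = 0) : spectralRadius ℂ A < 1 := by
  nontriviality Z
  obtain ⟨z, hz, hzr⟩ := spectrum.exists_nnnorm_eq_spectralRadius A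
  by_contra! hcon
  have hz1 : 1 ≤ ‖z‖ := by
    rw [← hzr] at hcon
    exact_mod_cast hcon
  have hD : ¬ IsUnit (algebraMap ℂ (Z →L[ℂ] Z) z - A) := hz
  have key : ∀ n : ℕ, ∃ u : Z, ‖u‖ = 1 ∧
      ‖(algebraMap ℂ (Z →L[ℂ] Z) z - A) u‖ ≤ 3 * (‖z‖ * (1 / ((n : ℝ) + 1))) := by
    intro n
    -- A point just outside the spectral disc, since |z| is the spectral radius: w - A is invertible
    -- and close to z - A, so its inverse is large.
    set w : ℂ := (1 + 1 / ((n : ℝ) + 1) : ℝ) * z with hw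
    have hpos : (0 : ℝ) < 1 / ((n : ℝ) + 1) := by positivity
    have hwn : ‖z‖ < ‖w‖ := by
      rw [hw, norm_mul, Complex.norm_real, Real.norm_of_nonneg (by positivity)]
      nlinarith
    obtain ⟨B, hB⟩ : IsUnit (algebraMap ℂ (Z →L[ℂ] Z) w - A) := by
      refine spectrum.mem_resolventSet_of_spectralRadius_lt ?_
      rw [← hzr]
      exact_mod_cast hwn
    have hBD : (algebraMap ℂ (Z →L[ℂ] Z) z - A) - B = (z - w) • 1 := by
      rw [hB, Algebra.algebraMap_eq_smul_one, Algebra.algebraMap_eq_smul_one, sub_smul]; abel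
    have hzw : ‖z - w‖ = ‖z‖ * (1 / ((n : ℝ) + 1)) := by
      have : z - w = -((1 / ((n : ℝ) + 1) : ℝ) * z) := by rw [hw]; push_cast; ring
      rw [this, norm_neg, norm_mul, Complex.norm_real, Real.norm_of_nonneg hpos.le, mul_comm]
    have h1 := one_le_norm_inverse_mul hD B
    rw [hBD, norm_smul, norm_one, mul_one] at h1
    obtain ⟨x, hx⟩ := exists_norm_lt_mul_norm_apply h1
    -- As (z - A)y = x + (z - w)y and ‖x‖ < 2|z - w|‖y‖, the normalized y is an approximate
    -- eigenvector, with constant 3 = 2 + 1.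
    set y := (↑B⁻¹ : Z →L[ℂ] Z) x with hy
    have hyx : (B : Z →L[ℂ] Z) y = x := by
      rw [hy, ← mul_apply_eq_comp]; simp
    have hy0 : 0 < ‖y‖ := by
      rw [norm_pos_iff]
      intro h0
      rw [h0, norm_zero, mul_zero] at hx
      exact absurd hx (not_lt.2 (norm_nonneg _))
    refine ⟨(‖y‖⁻¹ : ℂ) • y, ?_, ?_⟩
    · rw [norm_smul]; simp [hy0.ne']
    · have hDy : (algebraMap ℂ (Z →L[ℂ] Z) z - A) y = x + (z - w) • y := by
        have : algebraMap ℂ (Z →L[ℂ] Z) z - A = B + (z - w) • 1 := by rw [← hBD]; abel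
        rw [this]; simp [hyx]
      rw [map_smul, norm_smul, hDy, ← hzw]
      have h3 : ‖x + (z - w) • y‖ ≤ 3 * ‖z - w‖ * ‖y‖ := by
        refine (norm_add_le _ _).trans ?_
        rw [norm_smul]; linarith
      have h4 : ‖(‖y‖⁻¹ : ℂ)‖ = ‖y‖⁻¹ := by simp
      rw [h4, inv_mul_le_iff₀ hy0]
      linarith
  choose u hu1 hu2 using key
  have hlim : Tendsto (fun n => (algebraMap ℂ (Z →L[ℂ] Z) z - A) (u n))
      (hyperfilter ℕ : Ultrafilter ℕ) (𝓝 0) := by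
    refine squeeze_zero_norm hu2 ?_
    have h1 := (tendsto_one_div_add_atTop_nhds_zero_nat (𝕜 := ℝ)).mono_left
      (Nat.hyperfilter_le_atTop)
    simpa using (h1.const_mul ‖z‖).const_mul 3
  obtain ⟨y, hy⟩ := (hess z hz1).exists_tendsto _ (fun n => (hu1 n).le) hlim
  have hy1 : ‖y‖ = 1 := by
    refine tendsto_nhds_unique hy.norm ?_
    simp [hu1]
  have hy2 : (algebraMap ℂ (Z →L[ℂ] Z) z - A) y = 0 :=
    tendsto_nhds_unique
      (((algebraMap ℂ (Z →L[ℂ] Z) z - A).continuous.tendsto y).comp hy) hlim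
  have hy3 : A y = z • y := by
    rw [sub_apply, sub_eq_zero, Algebra.algebraMap_eq_smul_one] at hy2
    simpa using hy2.symm
  rw [heig z hz1 y hy3] at hy1
  simp at hy1

end SpectralRadius

noncomputable section

/-! ### Passing between the real space and its complexification. -/

section Complexification

variable {E : Type*} [MeasurableSpace E] {μ : Measure E} {p : ENNReal} [Fact (1 ≤ p)]

theorem reL_ofRealL (f : Lp ℝ p μ) : reL (ofRealL f) = f := by
  refine Lp.ext ?_
  filter_upwards [Complex.reCLM.coeFn_compLpL (p := p) (ofRealL f),
    Complex.ofRealCLM.coeFn_compLpL (p := p) f] with x h1 h2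
  simp only [reL, ofRealL] at *
  rw [h1, h2]; simp

theorem imL_ofRealL (f : Lp ℝ p μ) : imL (ofRealL f) = 0 := by
  refine Lp.ext ?_
  filter_upwards [Complex.imCLM.coeFn_compLpL (p := p) (ofRealL f),
    Complex.ofRealCLM.coeFn_compLpL (p := p) f, Lp.coeFn_zero ℝ p μ] with x h1 h2 h3
  simp only [imL, ofRealL] at *
  rw [h1, h2, h3]; simp

theorem ofRealL_reL_add_imL (f : Lp ℂ p μ) :
    ofRealL (reL f) + Complex.I • ofRealL (imL f) = f := by
  refine Lp.ext ?_
  filter_upwards [Complex.imCLM.coeFn_compLpL (p := p) f, Complex.reCLM.coeFn_compLpL (p := p) f,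
    Complex.ofRealCLM.coeFn_compLpL (p := p) (imL f),
    Complex.ofRealCLM.coeFn_compLpL (p := p) (reL f),
    Lp.coeFn_smul Complex.I (ofRealL (imL f)),
    Lp.coeFn_add (ofRealL (reL f)) (Complex.I • ofRealL (imL f))] with x h1 h2 h3 h4 h5 h6
  rw [h6, Pi.add_apply, h5, Pi.smul_apply]
  simp only [imL, ofRealL, reL] at *
  rw [h3, h4, h1, h2]
  simp [mul_comm Complex.I, Complex.re_add_im]

theorem ext_reL_imL {f g : Lp ℂ p μ} (hre : reL f = reL g) (him : imL f = imL g) : f = g := by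
  rw [← ofRealL_reL_add_imL f, ← ofRealL_reL_add_imL g, hre, him]

theorem norm_ofRealL (f : Lp ℝ p μ) : ‖ofRealL f‖ = ‖f‖ := by
  refine le_antisymm (Lp.norm_le_norm_of_ae_le ?_) (Lp.norm_le_norm_of_ae_le ?_) <;>
  · filter_upwards [Complex.ofRealCLM.coeFn_compLpL (p := p) f] with x h
    simp only [ofRealL] at *
    rw [h]; simp

theorem norm_reL_le (f : Lp ℂ p μ) : ‖reL f‖ ≤ ‖f‖ := by
  refine Lp.norm_le_norm_of_ae_le ?_
  filter_upwards [Complex.reCLM.coeFn_compLpL (p := p) f] with x h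
  simp only [reL] at *
  rw [h]; simpa using Complex.abs_re_le_norm (f x)

theorem norm_imL_le (f : Lp ℂ p μ) : ‖imL f‖ ≤ ‖f‖ := by
  refine Lp.norm_le_norm_of_ae_le ?_
  filter_upwards [Complex.imCLM.coeFn_compLpL (p := p) f] with x h
  simp only [imL] at *
  rw [h]; simpa using Complex.abs_im_le_norm (f x)

theorem reL_smul (z : ℂ) (f : Lp ℂ p μ) : reL (z • f) = z.re • reL f - z.im • imL f := by
  have key : z • f = z.re • f + z.im • (Complex.I • f) := by
    conv_lhs => rw [← Complex.re_add_im z]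
    rw [add_smul, mul_smul]
    rfl
  rw [key, map_add, map_smul, map_smul, reL_I_smul, smul_neg, sub_eq_add_neg]

theorem imL_smul (z : ℂ) (f : Lp ℂ p μ) : imL (z • f) = z.re • imL f + z.im • reL f := by
  have key : z • f = z.re • f + z.im • (Complex.I • f) := by
    conv_lhs => rw [← Complex.re_add_im z]
    rw [add_smul, mul_smul]
    rfl
  rw [key, map_add, map_smul, map_smul, imL_I_smul]

theorem reL_complexify (A : Lp ℝ p μ →L[ℝ] Lp ℝ p μ) (f : Lp ℂ p μ) :
    reL (complexify A f) = A (reL f) := by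
  rw [complexify_apply, map_add, reL_I_smul, reL_ofRealL, imL_ofRealL, neg_zero, add_zero]

theorem imL_complexify (A : Lp ℝ p μ →L[ℝ] Lp ℝ p μ) (f : Lp ℂ p μ) :
    imL (complexify A f) = A (imL f) := by
  rw [complexify_apply, map_add, imL_I_smul, reL_ofRealL, imL_ofRealL, zero_add]

theorem complexify_ofRealL (A : Lp ℝ p μ →L[ℝ] Lp ℝ p μ) (f : Lp ℝ p μ) :
    complexify A (ofRealL f) = ofRealL (A f) := by
  rw [complexify_apply, reL_ofRealL, imL_ofRealL, map_zero, map_zero, smul_zero, add_zero]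

theorem complexify_one : complexify (1 : Lp ℝ p μ →L[ℝ] Lp ℝ p μ) = 1 := by
  ext1 f
  refine ext_reL_imL ?_ ?_ <;> simp [reL_complexify, imL_complexify]

theorem complexify_mul (A B : Lp ℝ p μ →L[ℝ] Lp ℝ p μ) :
    complexify (A * B) = complexify A * complexify B := by
  ext1 f
  refine ext_reL_imL ?_ ?_ <;> simp [reL_complexify, imL_complexify]

theorem complexify_add (A B : Lp ℝ p μ →L[ℝ] Lp ℝ p μ) :
    complexify (A + B) = complexify A + complexify B := by
  ext1 f
  refine ext_reL_imL ?_ ?_ <;> simp [reL_complexify, imL_complexify]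

theorem complexify_sub (A B : Lp ℝ p μ →L[ℝ] Lp ℝ p μ) :
    complexify (A - B) = complexify A - complexify B := by
  ext1 f
  refine ext_reL_imL ?_ ?_ <;> simp [reL_complexify, imL_complexify]

theorem complexify_smul (c : ℝ) (A : Lp ℝ p μ →L[ℝ] Lp ℝ p μ) :
    complexify (c • A) = (c : ℂ) • complexify A := by
  ext1 f
  refine ext_reL_imL ?_ ?_
  · rw [reL_complexify, smul_apply, smul_apply, reL_smul, reL_complexify]; simp
  · rw [imL_complexify, smul_apply, smul_apply, imL_smul, imL_complexify]; simp

theorem complexify_pow (A : Lp ℝ p μ →L[ℝ] Lp ℝ p μ) (n : ℕ) :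
    complexify (A ^ n) = complexify A ^ n := by
  induction n with
  | zero => simp [complexify_one]
  | succ n ih => rw [pow_succ, pow_succ, complexify_mul, ih]

/-- The crude factor 2, from estimating real and imaginary parts separately, does no harm: only
exponential growth rates of powers are used. -/
theorem norm_complexify_le (A : Lp ℝ p μ →L[ℝ] Lp ℝ p μ) : ‖complexify A‖ ≤ 2 * ‖A‖ := by
  refine ContinuousLinearMap.opNorm_le_bound _ (by positivity) fun f => ?_
  rw [complexify_apply]
  refine (norm_add_le _ _).trans ?_
  rw [norm_smul, Complex.norm_I, one_mul, norm_ofRealL, norm_ofRealL]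
  have h1 : ‖A (reL f)‖ ≤ ‖A‖ * ‖f‖ := (A.le_opNorm _).trans (by gcongr; exact norm_reL_le f)
  have h2 : ‖A (imL f)‖ ≤ ‖A‖ * ‖f‖ := (A.le_opNorm _).trans (by gcongr; exact norm_imL_le f)
  linarith

theorem norm_le_norm_complexify (A : Lp ℝ p μ →L[ℝ] Lp ℝ p μ) : ‖A‖ ≤ ‖complexify A‖ := by
  refine ContinuousLinearMap.opNorm_le_bound _ (by positivity) fun f => ?_
  rw [← norm_ofRealL, ← complexify_ofRealL, ← norm_ofRealL f]
  exact ContinuousLinearMap.le_opNorm _ _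

theorem norm_pow_le_norm_pow (A : Lp ℝ p μ →L[ℝ] Lp ℝ p μ) (n : ℕ) : ‖A ^ n‖ ≤ ‖A‖ ^ n := by
  cases n with
  | zero =>
    rw [pow_zero, pow_zero]
    exact ContinuousLinearMap.norm_id_le
  | succ n => exact norm_pow_le' A n.succ_pos

/-- The spectrum of the complexification of `A` lies in the disc of radius `‖A‖`. -/
theorem isUnit_sub_complexify (A : Lp ℝ p μ →L[ℝ] Lp ℝ p μ) {z : ℂ} (hz : ‖A‖ < ‖z‖) :
    IsUnit (algebraMap ℂ (Lp ℂ p μ →L[ℂ] Lp ℂ p μ) z - complexify A) := by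
  by_contra hcon
  have hmem : z ∈ spectrum ℂ (complexify A) := hcon
  refine absurd (norm_le_of_mem_spectrum (C := 2) (norm_nonneg A) (fun n => ?_) hmem)
    (not_le.2 hz)
  rw [← complexify_pow]
  refine (norm_complexify_le _).trans ?_
  have := norm_pow_le_norm_pow A n
  linarith

theorem spectralRadius_complexify_ne_top (A : Lp ℝ p μ →L[ℝ] Lp ℝ p μ) :
    spectralRadius ℂ (complexify A) ≠ ⊤ := by
  refine ne_top_of_le_ne_top ENNReal.ofReal_ne_top (spectralRadius_le_of_norm_pow_le (C := 2)
    (norm_nonneg A) fun n => ?_)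
  rw [← complexify_pow]
  refine (norm_complexify_le _).trans ?_
  have := norm_pow_le_norm_pow A n
  linarith

theorem complexify_normalized (U : Lp ℝ p μ →L[ℝ] Lp ℝ p μ) :
    complexify (normalized U) = ((specRad U : ℂ))⁻¹ • complexify U := by
  rw [normalized, complexify_smul, Complex.ofReal_inv]

theorem spectralRadius_normalized {U : Lp ℝ p μ →L[ℝ] Lp ℝ p μ} (hU : 0 < specRad U) :
    spectralRadius ℂ (complexify (normalized U)) = 1 := by
  have hne : (specRad U : ℂ)⁻¹ ≠ 0 := inv_ne_zero (by exact_mod_cast hU.ne')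
  have hr : spectralRadius ℂ (complexify U) = ENNReal.ofReal (specRad U) :=
    (ENNReal.ofReal_toReal (spectralRadius_complexify_ne_top U)).symm
  -- On the zero space the spectral radius is 0, against `hU`.
  have hnt : Nontrivial (Lp ℂ p μ →L[ℂ] Lp ℂ p μ) := by
    by_contra h
    rw [not_nontrivial_iff_subsingleton] at h
    rw [spectrum.SpectralRadius.of_subsingleton, eq_comm, ENNReal.ofReal_eq_zero] at hr
    linarith
  have hspec : spectrum ℂ (complexify (normalized U)) =
      (fun z => (specRad U : ℂ)⁻¹ * z) '' spectrum ℂ (complexify U) := by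
    rw [complexify_normalized]
    exact spectrum.unit_smul_eq_smul (complexify U) (Units.mk0 _ hne)
  obtain ⟨z, hz, hzr⟩ := spectrum.exists_nnnorm_eq_spectralRadius (complexify U)
  have hzn : ‖z‖ = specRad U := by
    rw [specRad, ← hzr]; simp
  refine le_antisymm (iSup₂_le fun w hw => ?_) ?_
  · rw [hspec] at hw
    obtain ⟨y, hy, rfl⟩ := hw
    have hy1 : (‖y‖₊ : ENNReal) ≤ spectralRadius ℂ (complexify U) :=
      le_iSup₂ (α := ENNReal) y hy
    rw [hr, ← enorm_eq_nnnorm, ← ofReal_norm, ENNReal.ofReal_le_ofReal_iff hU.le] at hy1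
    rw [← enorm_eq_nnnorm, ← ofReal_norm, ENNReal.ofReal_le_one, norm_mul, norm_inv,
      Complex.norm_real, Real.norm_of_nonneg hU.le, inv_mul_le_iff₀ hU, mul_one]
    exact hy1
  · have hw : (specRad U : ℂ)⁻¹ * z ∈ spectrum ℂ (complexify (normalized U)) :=
      hspec ▸ ⟨z, hz, rfl⟩
    refine le_trans ?_ (le_iSup₂ (α := ENNReal) _ hw)
    rw [← enorm_eq_nnnorm, ← ofReal_norm, ENNReal.one_le_ofReal, norm_mul, norm_inv,
      Complex.norm_real, Real.norm_of_nonneg hU.le, hzn, inv_mul_cancel₀ hU.ne']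

/-- The splitting hypothesis makes `z - U / r(U)` essentially invertible for `|z| ≥ 1`. -/
theorem AdmitsSplitting.essInvertible {U : Lp ℝ p μ →L[ℝ] Lp ℝ p μ} (hU : AdmitsSplitting U)
    {z : ℂ} (hz : 1 ≤ ‖z‖) :
    EssInvertible (algebraMap ℂ (Lp ℂ p μ →L[ℂ] Lp ℂ p μ) z - complexify (normalized U)) := by
  obtain ⟨W, K, hUWK, hW, hK⟩ := hU
  have hr : 0 < specRad U := (norm_nonneg W).trans_lt hW
  have hrc : (specRad U : ℂ) ≠ 0 := by exact_mod_cast hr.ne'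
  have hrz : ‖W‖ < ‖(specRad U : ℂ) * z‖ := by
    rw [norm_mul, Complex.norm_real, Real.norm_of_nonneg hr.le]
    nlinarith
  obtain ⟨l, -, hl⟩ := hK _ hrz
  have hunit := isUnit_sub_complexify W hrz
  have hres : resolvent (complexify W) ((specRad U : ℂ) * z) *
      (algebraMap ℂ (Lp ℂ p μ →L[ℂ] Lp ℂ p μ) ((specRad U : ℂ) * z) - complexify W) = 1 :=
    Ring.inverse_mul_cancel _ hunit
  -- With ζ = r(U)z: ζ - U = (1 - K(ζ - W)⁻¹)(ζ - W).
  have hess : EssInvertible (algebraMap ℂ (Lp ℂ p μ →L[ℂ] Lp ℂ p μ) ((specRad U : ℂ) * z) -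
      complexify U) := by
    refine ⟨_, _, l, hunit, hl, ?_⟩
    have : complexify K ∘L resolvent (complexify W) ((specRad U : ℂ) * z) =
      complexify K * resolvent (complexify W) ((specRad U : ℂ) * z) := rfl
    rw [this, sub_mul, mul_assoc, hres, hUWK, complexify_add, one_mul, mul_one]
    abel
  convert hess.smul (inv_ne_zero hrc) using 1
  rw [complexify_normalized, smul_sub, Algebra.algebraMap_eq_smul_one,
    Algebra.algebraMap_eq_smul_one, smul_smul, inv_mul_cancel_left₀ hrc]

end Complexification

/-! ### Positive operators and positive resolvents on Banach lattices. -/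

section BanachLattice

theorem norm_le_norm_of_nonneg_of_le {X : Type*} [NormedAddCommGroup X] [Lattice X]
    [IsOrderedAddMonoid X] [HasSolidNorm X] {f g : X} (hf : 0 ≤ f) (h : f ≤ g) : ‖f‖ ≤ ‖g‖ := by
  refine norm_le_norm_of_abs_le_abs ?_
  rwa [abs_of_nonneg hf, abs_of_nonneg (hf.trans h)]

variable {X : Type*} [NormedAddCommGroup X] [Lattice X] [NormedSpace ℝ X]

/-- A positive operator on a Banach lattice. -/
def IsPositiveOp (A : X →L[ℝ] X) : Prop := ∀ f, 0 ≤ f → 0 ≤ A f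

theorem IsPositiveOp.one : IsPositiveOp (1 : X →L[ℝ] X) := fun _ hf => hf

theorem IsPositiveOp.mul {A B : X →L[ℝ] X} (hA : IsPositiveOp A) (hB : IsPositiveOp B) :
    IsPositiveOp (A * B) := fun f hf => hA _ (hB f hf)

theorem IsPositiveOp.pow {A : X →L[ℝ] X} (hA : IsPositiveOp A) (n : ℕ) :
    IsPositiveOp (A ^ n) := by
  induction n with
  | zero => exact IsPositiveOp.one
  | succ n ih => rw [pow_succ]; exact ih.mul hA

theorem IsPositiveOp.smul [PosSMulMono ℝ X] {A : X →L[ℝ] X} (hA : IsPositiveOp A) {c : ℝ}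
    (hc : 0 ≤ c) : IsPositiveOp (c • A) := fun f hf => smul_nonneg hc (hA f hf)

variable [IsOrderedAddMonoid X]

theorem IsPositiveOp.mono {A : X →L[ℝ] X} (hA : IsPositiveOp A) {f g : X} (h : f ≤ g) :
    A f ≤ A g := by
  have := hA _ (sub_nonneg.2 h)
  rwa [map_sub, sub_nonneg] at this

theorem IsPositiveOp.abs_apply_le {A : X →L[ℝ] X} (hA : IsPositiveOp A) (f : X) :
    |A f| ≤ A |f| := by
  refine abs_le'.2 ⟨hA.mono (le_abs_self f), ?_⟩
  rw [← map_neg]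
  exact hA.mono (neg_le_abs f)

variable [HasSolidNorm X]

theorem IsPositiveOp.norm_apply_le {A : X →L[ℝ] X} (hA : IsPositiveOp A) (f : X) :
    ‖A f‖ ≤ ‖A |f|‖ := by
  rw [← norm_abs_eq_norm]
  exact norm_le_norm_of_nonneg_of_le (abs_nonneg _) (hA.abs_apply_le f)

/-- Since |Af| ≤ A|f|, the norm of a positive operator is seen on nonnegative vectors; B itself need
not be positive. -/
theorem IsPositiveOp.opNorm_le_of_le {A B : X →L[ℝ] X} (hA : IsPositiveOp A)
    (h : ∀ f, 0 ≤ f → A f ≤ B f) : ‖A‖ ≤ ‖B‖ := by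
  refine ContinuousLinearMap.opNorm_le_bound _ (norm_nonneg _) fun f => ?_
  calc ‖A f‖ ≤ ‖A |f|‖ := hA.norm_apply_le f
    _ ≤ ‖B |f|‖ := norm_le_norm_of_nonneg_of_le (hA _ (abs_nonneg f)) (h _ (abs_nonneg f))
    _ ≤ ‖B‖ * ‖|f|‖ := B.le_opNorm _
    _ = ‖B‖ * ‖f‖ := by rw [norm_abs_eq_norm]

/-- The Neumann series of a positive operator is positive. -/
theorem IsPositiveOp.exists_unit_one_sub [CompleteSpace X] {A : X →L[ℝ] X}
    (hA : IsPositiveOp A) {C t : ℝ} (ht0 : 0 ≤ t) (ht : t < 1)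
    (h : ∀ n, ‖A ^ n‖ ≤ C * t ^ n) :
    ∃ B : (X →L[ℝ] X)ˣ, (B : X →L[ℝ] X) = 1 - A ∧ IsPositiveOp (↑B⁻¹ : X →L[ℝ] X) := by
  have hs : Summable (fun n => A ^ n) :=
    Summable.of_norm_bounded ((summable_geometric_of_lt_one ht0 ht).mul_left C) h
  refine ⟨⟨1 - A, ∑' n, A ^ n, hs.one_sub_mul_tsum_pow, hs.tsum_pow_mul_one_sub⟩, rfl,
    fun f hf => ?_⟩
  have h1 : HasSum (fun n => (A ^ n) f) ((∑' n, A ^ n) f) :=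
    hs.hasSum.mapL (ContinuousLinearMap.apply ℝ X f)
  exact h1.nonneg fun n => hA.pow n f hf

variable [PosSMulMono ℝ X]

/-- The resolvent of a positive operator is positive to the right of its growth bound. -/
theorem IsPositiveOp.exists_unit_smul_sub [CompleteSpace X] {A : X →L[ℝ] X}
    (hA : IsPositiveOp A) {C t s : ℝ} (ht0 : 0 ≤ t) (hts : t < s)
    (h : ∀ n, ‖A ^ n‖ ≤ C * t ^ n) :
    ∃ B : (X →L[ℝ] X)ˣ, (B : X →L[ℝ] X) = s • 1 - A ∧ IsPositiveOp (↑B⁻¹ : X →L[ℝ] X) := by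
  have hs : 0 < s := ht0.trans_lt hts
  obtain ⟨B, hB, hBpos⟩ := (hA.smul (inv_nonneg.2 hs.le)).exists_unit_one_sub (C := C) (t := t / s)
    (by positivity) ((div_lt_one hs).2 hts) fun n => by
      rw [smul_pow, norm_smul, norm_pow, norm_inv, Real.norm_of_nonneg hs.le, div_pow, inv_pow,
        inv_mul_le_iff₀ (by positivity)]
      have := h n
      field_simp
      linarith
  refine ⟨⟨s • (B : X →L[ℝ] X), s⁻¹ • (↑B⁻¹ : X →L[ℝ] X), ?_, ?_⟩, ?_, ?_⟩
  · rw [smul_mul_smul_comm, mul_inv_cancel₀ hs.ne', Units.mul_inv, one_smul]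
  · rw [smul_mul_smul_comm, inv_mul_cancel₀ hs.ne', Units.inv_mul, one_smul]
  · change s • (B : X →L[ℝ] X) = _
    rw [hB, smul_sub, smul_smul, mul_inv_cancel₀ hs.ne', one_smul]
  · exact hBpos.smul (inv_nonneg.2 hs.le)

/-- A positive resolvent at `s` controls the growth of the powers of a positive operator. -/
theorem IsPositiveOp.norm_pow_le {A R : X →L[ℝ] X} (hA : IsPositiveOp A) (hR : IsPositiveOp R)
    {s : ℝ} (hs : 0 ≤ s) (h : A * R = s • R - 1) (n : ℕ) : ‖A ^ n‖ ≤ ‖R‖ * s * s ^ n := by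
  -- Positivity of AR = sR - 1 gives 1 ≤ sR, the case n = 0. Each further A costs one factor s,
  -- because AR ≤ sR.
  have key : ∀ n : ℕ, ∀ f, 0 ≤ f → (A ^ n) f ≤ (s ^ (n + 1) • R) f := by
    intro n
    induction n with
    | zero =>
      intro f hf
      have h1 : 0 ≤ (A * R) f := hA.mul hR f hf
      rw [h, sub_apply, sub_nonneg] at h1
      simpa using h1
    | succ n ih =>
      intro f hf
      have h1 := hA.mono (ih f hf)
      rw [pow_succ', mul_apply_eq_comp]
      refine h1.trans ?_
      have h2 : A ((s ^ (n + 1) • R) f) = s ^ (n + 1) • (A * R) f := by simp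
      rw [h2, h]
      have h3 : (s • R - 1) f ≤ s • R f := by
        simpa using hf
      refine (smul_le_smul_of_nonneg_left h3 (by positivity)).trans_eq ?_
      rw [smul_smul, ← pow_succ]; rfl
  refine ((hA.pow n).opNorm_le_of_le (key n)).trans_eq ?_
  rw [norm_smul, norm_pow, Real.norm_of_nonneg hs]
  ring

/-- If a positive operator with positive resolvent `B⁻¹` at `s > 1` satisfies
`‖B⁻¹‖ (s - 1) < 1`, then its growth bound is smaller than one. -/
theorem IsPositiveOp.exists_norm_pow_le [CompleteSpace X] {A : X →L[ℝ] X} (hA : IsPositiveOp A)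
    {s : ℝ} (hs : 1 < s) (B : (X →L[ℝ] X)ˣ) (hB : (B : X →L[ℝ] X) = s • 1 - A)
    (hBpos : IsPositiveOp (↑B⁻¹ : X →L[ℝ] X))
    (hlt : ‖(↑B⁻¹ : X →L[ℝ] X)‖ * (s - 1) < 1) :
    ∃ C t : ℝ, 0 < t ∧ t < 1 ∧ ∀ n, ‖A ^ n‖ ≤ C * t ^ n := by
  set R : X →L[ℝ] X := ↑B⁻¹ with hR
  -- The strict inequality at t = 1 persists slightly to the left, so the Neumann series reaches a
  -- point below one.
  obtain ⟨t, ht0, ht1, htR⟩ : ∃ t : ℝ, 0 < t ∧ t < 1 ∧ ‖R‖ * (s - t) < 1 := by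
    have hc : ContinuousAt (fun t : ℝ => ‖R‖ * (s - t)) 1 := by fun_prop
    have h1 := hc.eventually_lt_const hlt
    have h2 := (h1.filter_mono nhdsWithin_le_nhds).and
      (Ioo_mem_nhdsLT (zero_lt_one' ℝ))
    obtain ⟨t, h3, h4⟩ := (h2 : ∀ᶠ t in 𝓝[<] (1 : ℝ), _).exists
    exact ⟨t, h4.1, h4.2, h3⟩
  have hδ : 0 ≤ s - t := by linarith
  have hpos : IsPositiveOp ((s - t) • R) := hBpos.smul hδ
  have hnorm : ‖(s - t) • R‖ < 1 := by
    rw [norm_smul, Real.norm_of_nonneg hδ, mul_comm]; exact htR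
  obtain ⟨Q, hQ, hQpos⟩ := hpos.exists_unit_one_sub (C := 1) (norm_nonneg _) hnorm fun n => by
    rw [one_mul]
    cases n with
    | zero =>
      rw [pow_zero, pow_zero]
      exact ContinuousLinearMap.norm_id_le
    | succ n => exact norm_pow_le' _ n.succ_pos
  -- t - A = (s - A)(1 - (s - t)R), and the inverses of both factors are positive.
  have hBQ : ((B * Q : (X →L[ℝ] X)ˣ) : X →L[ℝ] X) = t • 1 - A := by
    rw [Units.val_mul, hQ, mul_sub, mul_one, mul_smul_comm, hR, Units.mul_inv, hB, sub_smul]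
    abel
  have hinv := Units.mul_inv (B * Q)
  rw [hBQ, sub_mul, smul_mul_assoc, one_mul] at hinv
  refine ⟨_, t, ht0, ht1, fun n => hA.norm_pow_le (R := ↑(B * Q)⁻¹) ?_ ht0.le ?_ n⟩
  · rw [mul_inv_rev, Units.val_mul]
    exact hQpos.mul hBpos
  · rw [← hinv]; abel

/-- A nonzero positive vector is not annihilated by all positive functionals. -/
theorem exists_positive_functional {f : X} (hf : 0 ≤ f) (hf0 : f ≠ 0) :
    ∃ φ : StrongDual ℝ X, (∀ g, 0 ≤ g → 0 ≤ φ g) ∧ 0 < φ f := by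
  have hmem : -f ∉ ProperCone.positive ℝ X := by
    intro h
    have h1 : 0 ≤ -f := h
    exact hf0 (le_antisymm (neg_nonneg.1 h1) hf)
  obtain ⟨φ, h1, h2⟩ := (ProperCone.positive ℝ X).hyperplane_separation_point hmem
  refine ⟨φ, fun g hg => h1 g hg, ?_⟩
  simpa using h2

end BanachLattice

/-- **Banach-Alaoglu** in terms of ultrafilters. -/
theorem exists_tendsto_functional {X ι : Type*} [NormedAddCommGroup X] [NormedSpace ℝ X]
    (𝓤 : Ultrafilter ι) {ψ : ι → StrongDual ℝ X} {C : ℝ} (hψ : ∀ i, ‖ψ i‖ ≤ C) :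
    ∃ ψ₀ : StrongDual ℝ X, ∀ x, Tendsto (fun i => ψ i x) 𝓤 (𝓝 (ψ₀ x)) := by
  have hK := WeakDual.isCompact_closedBall (0 : StrongDual ℝ X) C
  have hmem : ((𝓤.map fun i => StrongDual.toWeakDual (ψ i) : Ultrafilter (WeakDual ℝ X)) :
      Filter (WeakDual ℝ X)) ≤ 𝓟 (WeakDual.toStrongDual ⁻¹' Metric.closedBall 0 C) := by
    rw [le_principal_iff]
    refine Filter.mem_map.2 (Filter.univ_mem' fun i => ?_)
    simpa using hψ i
  obtain ⟨y, -, hy⟩ := isCompact_iff_ultrafilter_le_nhds.1 hK _ hmem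
  refine ⟨WeakDual.toStrongDual y, fun x => ?_⟩
  have hy' : Tendsto (fun i => StrongDual.toWeakDual (ψ i)) 𝓤 (𝓝 y) := hy
  exact ((WeakDual.eval_continuous x).tendsto y).comp hy'

/-! ### Krein-Rutman: positive fixed vectors of V and of its dual. -/

section Existence

variable {E : Type*} [MeasurableSpace E] {μ : Measure E} {p : ENNReal} [Fact (1 ≤ p)]

instance instPosSMulMonoLp : PosSMulMono ℝ (Lp ℝ p μ) where
  smul_le_smul_of_nonneg_left c hc f g hfg := by
    rw [← Lp.coeFn_le] at hfg ⊢
    filter_upwards [hfg, Lp.coeFn_smul c f, Lp.coeFn_smul c g] with x h h1 h2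
    rw [h1, h2]
    exact mul_le_mul_of_nonneg_left h hc

/-- If the spectral radius of the positive operator `V` is one, the resolvent of `V` at `s > 1`
is positive and blows up as `s → 1`. -/
theorem IsPositiveOp.exists_resolvent {V : Lp ℝ p μ →L[ℝ] Lp ℝ p μ} (hV : IsPositiveOp V)
    (hr : spectralRadius ℂ (complexify V) = 1) {s : ℝ} (hs : 1 < s) :
    ∃ B : (Lp ℝ p μ →L[ℝ] Lp ℝ p μ)ˣ, (B : Lp ℝ p μ →L[ℝ] Lp ℝ p μ) = s • 1 - V ∧
      IsPositiveOp (↑B⁻¹ : Lp ℝ p μ →L[ℝ] Lp ℝ p μ) ∧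
      1 ≤ ‖(↑B⁻¹ : Lp ℝ p μ →L[ℝ] Lp ℝ p μ)‖ * (s - 1) := by
  obtain ⟨t, ht1, hts⟩ := exists_between hs
  have ht0 : 0 < t := one_pos.trans ht1
  obtain ⟨C, -, hC⟩ := exists_norm_pow_le_of_spectralRadius_lt (complexify V) ht0
    (by rw [hr]; simpa using ht1)
  have hC' : ∀ n, ‖V ^ n‖ ≤ C * t ^ n := fun n =>
    (norm_le_norm_complexify _).trans (by rw [complexify_pow]; exact hC n)
  obtain ⟨B, hB, hBpos⟩ := hV.exists_unit_smul_sub ht0.le hts hC'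
  refine ⟨B, hB, hBpos, ?_⟩
  by_contra! hcon
  obtain ⟨C', t', ht0', ht1', h⟩ := hV.exists_norm_pow_le hs B hB hBpos hcon
  have h1 : spectralRadius ℂ (complexify V) ≤ ENNReal.ofReal t' := by
    refine spectralRadius_le_of_norm_pow_le (C := 2 * C') ht0'.le fun n => ?_
    rw [← complexify_pow]
    refine (norm_complexify_le _).trans ?_
    have := h n
    linarith
  rw [hr, ENNReal.one_le_ofReal] at h1
  linarith

theorem one_lt_one_add_one_div (n : ℕ) : 1 < 1 + 1 / ((n : ℝ) + 1) :=
  lt_add_of_pos_right _ (by positivity)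

theorem tendsto_one_div_add_one_hyperfilter :
    Tendsto (fun n : ℕ => 1 / ((n : ℝ) + 1)) (hyperfilter ℕ : Ultrafilter ℕ) (𝓝 0) :=
  (tendsto_one_div_add_atTop_nhds_zero_nat (𝕜 := ℝ)).mono_left Nat.hyperfilter_le_atTop

/-- **Krein-Rutman**: existence of a positive eigenvector for the spectral radius. -/
theorem IsPositiveOp.exists_eigenvector {V : Lp ℝ p μ →L[ℝ] Lp ℝ p μ} (hV : IsPositiveOp V)
    (hr : spectralRadius ℂ (complexify V) = 1)
    (hess : EssInvertible (1 - complexify V)) : ∃ f, 0 ≤ f ∧ f ≠ 0 ∧ V f = f := by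
  have key : ∀ n : ℕ, ∃ u : Lp ℝ p μ, 0 ≤ u ∧ ‖u‖ = 1 ∧
      ‖u - V u‖ ≤ 3 * (1 / ((n : ℝ) + 1)) := by
    intro n
    obtain ⟨B, hB, hBpos, hB1⟩ := hV.exists_resolvent hr (one_lt_one_add_one_div n)
    rw [add_sub_cancel_left] at hB1
    have hpos : (0 : ℝ) < 1 / ((n : ℝ) + 1) := by positivity
    obtain ⟨x, hx⟩ := exists_norm_lt_mul_norm_apply hB1
    -- Replacing x by |x| keeps its norm and, the resolvent being positive, does not decrease the
    -- norm of its image; the approximate fixed vector becomes nonnegative.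
    set y := (↑B⁻¹ : Lp ℝ p μ →L[ℝ] Lp ℝ p μ) |x| with hy
    have hx' : ‖(|x|)‖ < 2 * (1 / ((n : ℝ) + 1)) * ‖y‖ := by
      rw [norm_abs_eq_norm]
      refine hx.trans_le ?_
      gcongr
      exact hBpos.norm_apply_le x
    have hy0 : 0 < ‖y‖ := by
      by_contra! h0
      have h1 := norm_nonneg (|x|)
      nlinarith
    have hBy : (B : Lp ℝ p μ →L[ℝ] Lp ℝ p μ) y = |x| := by
      rw [hy, ← mul_apply_eq_comp, Units.mul_inv, one_apply_eq_self]
    have hVy : y - V y = |x| - (1 / ((n : ℝ) + 1)) • y := by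
      rw [← hBy, hB]
      simp only [sub_apply, add_smul, one_smul, add_apply, smul_apply, one_apply_eq_self]
      abel
    refine ⟨‖y‖⁻¹ • y, smul_nonneg (by positivity) (hBpos _ (abs_nonneg x)), ?_, ?_⟩
    · rw [norm_smul, norm_inv, norm_norm, inv_mul_cancel₀ hy0.ne']
    · rw [map_smul, ← smul_sub, norm_smul, norm_inv, norm_norm, inv_mul_le_iff₀ hy0, hVy]
      refine (norm_sub_le _ _).trans ?_
      rw [norm_smul, Real.norm_of_nonneg hpos.le]
      linarith
  choose u hu0 hu1 hu2 using key
  have hlim : Tendsto (fun n => u n - V (u n)) (hyperfilter ℕ : Ultrafilter ℕ) (𝓝 0) := by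
    refine squeeze_zero_norm hu2 ?_
    simpa using tendsto_one_div_add_one_hyperfilter.const_mul 3
  -- Essential invertibility is available on the complex space only, so the limit is taken there and
  -- its real part returned.
  have hlimC : Tendsto (fun n => (1 - complexify V) (ofRealL (u n)))
      (hyperfilter ℕ : Ultrafilter ℕ) (𝓝 0) := by
    have := ((ofRealL (μ := μ) (p := p)).continuous.tendsto 0).comp hlim
    rw [map_zero] at this
    refine this.congr fun n => ?_
    rw [sub_apply, one_apply_eq_self, complexify_ofRealL, ← map_sub]
    rfl
  obtain ⟨y, hy⟩ := hess.exists_tendsto _ (fun n => (by rw [norm_ofRealL, hu1] : _ ≤ (1 : ℝ))) hlimC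
  have hf : Tendsto u (hyperfilter ℕ : Ultrafilter ℕ) (𝓝 (reL y)) := by
    refine (((reL (μ := μ) (p := p)).continuous.tendsto y).comp hy).congr fun n => ?_
    exact reL_ofRealL (u n)
  refine ⟨reL y, ge_of_tendsto' hf hu0, ?_, ?_⟩
  · have : ‖reL y‖ = 1 := tendsto_nhds_unique hf.norm (by simp [hu1])
    intro h
    rw [h, norm_zero] at this
    exact zero_ne_one this
  · have h1 := hf.sub ((V.continuous.tendsto _).comp hf)
    exact (sub_eq_zero.1 (tendsto_nhds_unique h1 hlim)).symm

/-- **Krein-Rutman** for the dual operator. -/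
theorem IsPositiveOp.exists_dual_eigenvector {V : Lp ℝ p μ →L[ℝ] Lp ℝ p μ} (hV : IsPositiveOp V)
    (hr : spectralRadius ℂ (complexify V) = 1) (hess : EssInvertible (1 - complexify V))
    {f₀ : Lp ℝ p μ} (hf₀ : 0 ≤ f₀) (hf₀' : f₀ ≠ 0) (hVf₀ : V f₀ = f₀) :
    ∃ ψ : StrongDual ℝ (Lp ℝ p μ), (∀ f, 0 ≤ f → 0 ≤ ψ f) ∧ ψ ≠ 0 ∧ ∀ f, ψ (V f) = ψ f := by
  obtain ⟨φ, hφ, hφf₀⟩ := exists_positive_functional hf₀ hf₀'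
  have hf₀n : 0 < ‖f₀‖ := norm_pos_iff.2 hf₀'
  -- Chosen to bound ‖φ‖/‖χ‖ + s by sM, given the lower bound ‖χ‖ ≥ φ(f₀)/(s‖f₀‖) obtained below.
  set M : ℝ := ‖f₀‖ / φ f₀ * ‖φ‖ + 1 with hM
  have key : ∀ n : ℕ, ∃ ψ : StrongDual ℝ (Lp ℝ p μ), (∀ f, 0 ≤ f → 0 ≤ ψ f) ∧ ‖ψ‖ = 1 ∧
      ∀ x, |ψ (x - V x)| ≤ 1 / ((n : ℝ) + 1) * M * ‖x‖ := by
    intro n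
    obtain ⟨B, hB, hBpos, -⟩ := hV.exists_resolvent hr (one_lt_one_add_one_div n)
    have hpos : (0 : ℝ) < 1 / ((n : ℝ) + 1) := by positivity
    -- Here s is the distance to 1: the resolvent R is taken at 1 + s.
    set s : ℝ := 1 / ((n : ℝ) + 1) with hs
    set R : Lp ℝ p μ →L[ℝ] Lp ℝ p μ := ↑B⁻¹ with hR
    have hRB : ∀ x, R (x - V x) = x - s • R x := by
      intro x
      have h1 : (R * (B : Lp ℝ p μ →L[ℝ] Lp ℝ p μ)) x = x := by
        rw [hR, Units.inv_mul, one_apply_eq_self]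
      rw [hB] at h1
      simp only [mul_apply_eq_comp, sub_apply, add_smul, one_smul, add_apply, smul_apply,
        one_apply_eq_self, map_sub, map_add, map_smul] at h1
      rw [map_sub, eq_sub_iff_add_eq]
      refine Eq.trans ?_ h1
      abel
    -- The resolvent acts on the fixed vector as 1/s, which forces φ ∘ R to blow up like 1/s.
    have hRf₀ : f₀ = s • R f₀ := by
      have := hRB f₀
      rwa [hVf₀, sub_self, map_zero, eq_comm, sub_eq_zero] at this
    set χ : StrongDual ℝ (Lp ℝ p μ) := φ ∘L R with hχ
    have hχf₀ : φ f₀ ≤ s * (‖χ‖ * ‖f₀‖) := by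
      have h1 : φ f₀ = s * χ f₀ := by
        conv_lhs => rw [hRf₀, map_smul]
        rfl
      rw [h1]
      gcongr
      exact (le_abs_self _).trans (χ.le_opNorm f₀)
    have hχ0 : 0 < ‖χ‖ := by
      by_contra! h0
      have : ‖χ‖ = 0 := le_antisymm h0 (norm_nonneg _)
      rw [this] at hχf₀
      linarith
    refine ⟨‖χ‖⁻¹ • χ, fun f hf => ?_, ?_, fun x => ?_⟩
    · exact mul_nonneg (by positivity) (hφ _ (hBpos f hf))
    · rw [norm_smul, norm_inv, norm_norm, inv_mul_cancel₀ hχ0.ne']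
    · have h1 : χ (x - V x) = φ x - s * χ x := by
        change φ (R (x - V x)) = _
        rw [hRB, map_sub, map_smul]
        rfl
      have h2 : |χ (x - V x)| ≤ ‖φ‖ * ‖x‖ + s * (‖χ‖ * ‖x‖) := by
        rw [h1]
        refine (abs_sub _ _).trans ?_
        rw [abs_mul, abs_of_pos hpos]
        gcongr
        · exact φ.le_opNorm x
        · exact χ.le_opNorm x
      have h3 : 1 ≤ s * (‖χ‖ * (‖f₀‖ / φ f₀)) := by
        rw [← mul_assoc, ← mul_div_assoc, le_div_iff₀ hφf₀, one_mul]
        linarith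
      rw [smul_apply, smul_eq_mul, abs_mul, abs_inv, abs_norm, inv_mul_le_iff₀ hχ0]
      refine h2.trans ?_
      have h4 : ‖φ‖ * ‖x‖ ≤ s * (‖χ‖ * (‖f₀‖ / φ f₀)) * (‖φ‖ * ‖x‖) :=
        le_mul_of_one_le_left (by positivity) h3
      calc ‖φ‖ * ‖x‖ + s * (‖χ‖ * ‖x‖)
          ≤ s * (‖χ‖ * (‖f₀‖ / φ f₀)) * (‖φ‖ * ‖x‖) + s * (‖χ‖ * ‖x‖) := by gcongr
        _ = ‖χ‖ * (s * M * ‖x‖) := by rw [hM]; ring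
  choose ψ hψ0 hψ1 hψ2 using key
  obtain ⟨ψ₀, hlim⟩ := exists_tendsto_functional (hyperfilter ℕ) (fun n => (hψ1 n).le)
  have hε : Tendsto (fun n : ℕ => 1 / ((n : ℝ) + 1) * M) (hyperfilter ℕ : Ultrafilter ℕ) (𝓝 0) := by
    simpa using tendsto_one_div_add_one_hyperfilter.mul_const M
  refine ⟨ψ₀, fun f hf => ge_of_tendsto' (hlim f) fun n => hψ0 n f hf, ?_, fun f => ?_⟩
  -- A weak-* limit of unit functionals may vanish in general. Here
  -- `EssInvertible.tendsto_functional` would make ψ n small on almost norming unit-ball vectors,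
  -- against |ψ n (x n)| > 1/2.
  · rintro rfl
    have hx : ∀ n, ∃ x : Lp ℝ p μ, ‖x‖ < 1 ∧ 1 / 2 < ‖ψ n x‖ := fun n =>
      (ψ n).exists_lt_apply_of_lt_opNorm (by rw [hψ1]; norm_num)
    choose x hx1 hx2 using hx
    have h := hess.tendsto_functional (hyperfilter ℕ) (C := 1) (M := 1)
      (Ψ := fun n => ((ψ n ∘L reL : Lp ℂ p μ →L[ℝ] ℝ) : Lp ℂ p μ →+ ℝ))
      (x := fun n => ofRealL (x n)) ?_ hε ?_ ?_ ?_
    · have h1 : Tendsto (fun n => ψ n (x n)) (hyperfilter ℕ : Ultrafilter ℕ) (𝓝 0) := by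
        refine h.congr fun n => ?_
        change ψ n (reL (ofRealL (x n))) = _
        rw [reL_ofRealL]
      have h2 : (1 / 2 : ℝ) ≤ ‖(0 : ℝ)‖ := ge_of_tendsto' h1.norm fun n => (hx2 n).le
      norm_num at h2
    · intro n y
      change ‖ψ n (reL y)‖ ≤ _
      refine ((ψ n).le_opNorm _).trans ?_
      rw [hψ1]
      gcongr
      exact norm_reL_le y
    · intro n y
      change |ψ n (reL ((1 - complexify V) y))| ≤ _
      rw [sub_apply, one_apply_eq_self, map_sub, reL_complexify]
      refine (hψ2 n _).trans ?_
      gcongr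
      exact norm_reL_le y
    · intro y
      exact hlim (reL y)
    · intro n
      rw [norm_ofRealL]
      exact (hx1 n).le
  · have h1 : Tendsto (fun n => ψ n (f - V f)) (hyperfilter ℕ : Ultrafilter ℕ) (𝓝 0) := by
      refine squeeze_zero_norm (fun n => hψ2 n f) ?_
      simpa using hε.mul_const ‖f‖
    have h2 := tendsto_nhds_unique h1 (hlim _)
    rw [map_sub] at h2
    linarith

end Existence

end

/-! ### Riesz representation of positive functionals by Radon-Nikodym. -/

section RieszRepresentation

variable {E : Type*} [MeasurableSpace E] {μ : Measure E} {p : ENNReal} [Fact (1 ≤ p)]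

/-- Dominated convergence in `L^p`. -/
theorem tendsto_Lp_of_dominated (hp : p ≠ ⊤) {F : ℕ → Lp ℝ p μ} {f : Lp ℝ p μ}
    (h0 : ∀ n, ∀ᵐ x ∂μ, 0 ≤ F n x) (hle : ∀ n, ∀ᵐ x ∂μ, F n x ≤ f x)
    (hlim : ∀ᵐ x ∂μ, Tendsto (fun n => F n x) atTop (𝓝 (f x))) :
    Tendsto F atTop (𝓝 f) := by
  have hp0 : p ≠ 0 := (zero_lt_one.trans_le Fact.out).ne'
  have hpos : 0 < p.toReal := ENNReal.toReal_pos hp0 hp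
  rw [Lp.tendsto_Lp_iff_tendsto_eLpNorm']
  have hdom : Tendsto (fun n => ∫⁻ x, ‖(⇑(F n) - ⇑f) x‖ₑ ^ p.toReal ∂μ) atTop
      (𝓝 (∫⁻ _, (0 : ENNReal) ∂μ)) := by
    refine tendsto_lintegral_of_dominated_convergence' (fun x => ‖f x‖ₑ ^ p.toReal)
      (fun n => ?_) (fun n => ?_) ?_ ?_
    · exact (((Lp.aestronglyMeasurable (F n)).sub
        (Lp.aestronglyMeasurable f)).enorm).pow_const _
    · filter_upwards [h0 n, hle n] with x h1 h2
      refine ENNReal.rpow_le_rpow ?_ hpos.le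
      rw [enorm_le_iff_norm_le, Pi.sub_apply, Real.norm_eq_abs, Real.norm_eq_abs,
        abs_of_nonneg (h1.trans h2), abs_of_nonpos (by linarith)]
      linarith
    · exact ((eLpNorm_lt_top_iff_lintegral_rpow_enorm_lt_top hp0 hp).1 (Lp.eLpNorm_lt_top f)).ne
    · filter_upwards [hlim] with x hx
      have h1 : Tendsto (fun n => ‖F n x - f x‖ₑ) atTop (𝓝 0) := by
        have := (hx.sub_const (f x)).enorm
        simpa using this
      have h2 := (ENNReal.continuous_rpow_const (y := p.toReal)).tendsto 0 |>.comp h1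
      rw [ENNReal.zero_rpow_of_pos hpos] at h2
      exact h2
  rw [lintegral_zero] at hdom
  have h3 := (ENNReal.continuous_rpow_const (y := 1 / p.toReal)).tendsto 0 |>.comp hdom
  rw [ENNReal.zero_rpow_of_pos (by positivity)] at h3
  refine h3.congr fun n => ?_
  rw [eLpNorm_eq_lintegral_rpow_enorm_toReal hp0 hp]
  rfl

omit [Fact (1 ≤ p)] in
theorem toLp_nonneg {f : E → ℝ} (hf : MemLp f p μ) (h : ∀ᵐ x ∂μ, 0 ≤ f x) : 0 ≤ hf.toLp f := by
  rw [← Lp.coeFn_nonneg]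
  filter_upwards [hf.coeFn_toLp, h] with x h1 h2
  rw [h1]; exact h2

/-- Countable additivity of `A ↦ ψ (1_A w)`. -/
theorem hasSum_functional_indicator (hp : p ≠ ⊤) (ψ : StrongDual ℝ (Lp ℝ p μ)) {w : E → ℝ}
    (hw : MemLp w p μ) (hw0 : ∀ x, 0 ≤ w x) {A : ℕ → Set E} (hA : ∀ n, MeasurableSet (A n))
    (hd : Pairwise (Function.onFun Disjoint A)) :
    Tendsto (fun n => ∑ i ∈ Finset.range n, ψ ((hw.indicator (hA i)).toLp _)) atTop
      (𝓝 (ψ ((hw.indicator (MeasurableSet.iUnion hA)).toLp _))) := by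
  have hS : ∀ n, MeasurableSet (⋃ i ∈ Finset.range n, A i) := fun n =>
    Finset.measurableSet_biUnion _ fun i _ => hA i
  have hsum : ∀ n, ∑ i ∈ Finset.range n, ψ ((hw.indicator (hA i)).toLp _) =
      ψ ((hw.indicator (hS n)).toLp _) := by
    intro n
    induction n with
    | zero =>
      rw [Finset.sum_range_zero, eq_comm]
      have : (hw.indicator (hS 0)).toLp _ = (0 : Lp ℝ p μ) := by
        rw [← MemLp.toLp_zero (MemLp.zero (ε := ℝ) (p := p) (μ := μ))]
        refine MemLp.toLp_congr _ _ (Eventually.of_forall fun x => ?_)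
        simp
      rw [this, map_zero]
    | succ n ih =>
      rw [Finset.sum_range_succ, ih, ← map_add, ← MemLp.toLp_add]
      congr 1
      refine MemLp.toLp_congr _ _ (Eventually.of_forall fun x => ?_)
      have hdis : Disjoint (⋃ i ∈ Finset.range n, A i) (A n) := by
        simp only [Set.disjoint_iUnion_left]
        exact fun i hi => hd (Finset.mem_range.1 hi).ne
      have hun : (⋃ i ∈ Finset.range (n + 1), A i) = (⋃ i ∈ Finset.range n, A i) ∪ A n := by
        rw [Finset.range_add_one, Finset.set_biUnion_insert, Set.union_comm]
      rw [hun, Set.indicator_union_of_disjoint hdis]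
      rfl
  simp_rw [hsum]
  refine (ψ.continuous.tendsto _).comp (tendsto_Lp_of_dominated hp (fun n => ?_) (fun n => ?_) ?_)
  · filter_upwards [(hw.indicator (hS n)).coeFn_toLp] with x h
    rw [h]; exact Set.indicator_nonneg (fun y _ => hw0 y) x
  · filter_upwards [(hw.indicator (hS n)).coeFn_toLp,
      (hw.indicator (MeasurableSet.iUnion hA)).coeFn_toLp] with x h h'
    rw [h, h']
    refine Set.indicator_le_indicator_of_subset ?_ hw0 x
    exact Set.iUnion₂_subset fun i _ => Set.subset_iUnion A i
  · have h1 : ∀ᵐ x ∂μ, ∀ n, (hw.indicator (hS n)).toLp _ x =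
        (⋃ i ∈ Finset.range n, A i).indicator w x :=
      ae_all_iff.2 fun n => (hw.indicator (hS n)).coeFn_toLp
    filter_upwards [h1, (hw.indicator (MeasurableSet.iUnion hA)).coeFn_toLp] with x h h'
    simp_rw [h, h']
    refine tendsto_const_nhds.congr' ?_
    by_cases hx : x ∈ ⋃ i, A i
    · obtain ⟨i, hi⟩ := Set.mem_iUnion.1 hx
      filter_upwards [eventually_gt_atTop i] with n hn
      rw [Set.indicator_of_mem hx, Set.indicator_of_mem]
      exact Set.mem_iUnion₂.2 ⟨i, Finset.mem_range.2 hn, hi⟩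
    · refine Eventually.of_forall fun n => ?_
      beta_reduce
      rw [Set.indicator_of_notMem hx, Set.indicator_of_notMem]
      exact fun h => hx (Set.iUnion₂_subset (fun i _ => Set.subset_iUnion A i) h)

/-- The Radon-Nikodym density of a positive functional on `L^p`, relative to a weight `w`. -/
theorem exists_density_indicator [SigmaFinite μ] (hp : p ≠ ⊤) (ψ : StrongDual ℝ (Lp ℝ p μ))
    (hψ : ∀ f, 0 ≤ f → 0 ≤ ψ f) {w : E → ℝ} (hw : MemLp w p μ) (hw0 : ∀ x, 0 ≤ w x) :
    ∃ k : E → ENNReal, Measurable k ∧ (∀ᵐ x ∂μ, k x < ⊤) ∧ ∀ (A : Set E) (hA : MeasurableSet A),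
      ∫⁻ x in A, k x ∂μ = ENNReal.ofReal (ψ ((hw.indicator hA).toLp _)) := by
  have hpos : ∀ (A : Set E) (hA : MeasurableSet A), 0 ≤ ψ ((hw.indicator hA).toLp _) :=
    fun A hA => hψ _ (toLp_nonneg _
      (Eventually.of_forall (Set.indicator_nonneg fun y _ => hw0 y)))
  have hzero : ∀ (A : Set E) (hA : MeasurableSet A), μ A = 0 →
      ψ ((hw.indicator hA).toLp _) = 0 := by
    intro A hA h
    have : (hw.indicator hA).toLp _ = (0 : Lp ℝ p μ) := by
      rw [← MemLp.toLp_zero (MemLp.zero (ε := ℝ) (p := p) (μ := μ))]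
      refine MemLp.toLp_congr _ _ ?_
      exact indicator_meas_zero h
    rw [this, map_zero]
  -- The weight w lies in L^p, so 1_A w does for every measurable A, and ν is a finite measure even
  -- when μ is infinite.
  let ν : Measure E := Measure.ofMeasurable
    (fun A hA => ENNReal.ofReal (ψ ((hw.indicator hA).toLp _)))
    (by rw [hzero _ MeasurableSet.empty measure_empty, ENNReal.ofReal_zero])
    (fun A hA hd => by
      have h1 := hasSum_functional_indicator hp ψ hw hw0 hA hd
      have h2 : HasSum (fun i => ψ ((hw.indicator (hA i)).toLp _)) _ :=
        (hasSum_iff_tendsto_nat_of_nonneg (fun i => hpos _ (hA i)) _).2 h1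
      rw [← h2.tsum_eq, ENNReal.ofReal_tsum_of_nonneg (fun i => hpos _ (hA i)) h2.summable])
  have hν : ∀ (A : Set E) (hA : MeasurableSet A),
      ν A = ENNReal.ofReal (ψ ((hw.indicator hA).toLp _)) :=
    fun A hA => Measure.ofMeasurable_apply A hA
  have hac : ν ≪ μ := Measure.AbsolutelyContinuous.mk fun A hA h => by
    rw [hν A hA, hzero A hA h, ENNReal.ofReal_zero]
  have hfin : IsFiniteMeasure ν := ⟨by rw [hν _ MeasurableSet.univ]; exact ENNReal.ofReal_lt_top⟩
  refine ⟨ν.rnDeriv μ, Measure.measurable_rnDeriv _ _, Measure.rnDeriv_lt_top ν μ,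
    fun A hA => ?_⟩
  rw [← withDensity_apply _ hA, Measure.withDensity_rnDeriv_eq _ _ hac, hν A hA]

omit [Fact (1 ≤ p)] in
theorem memLp_simpleFunc_mul {w : E → ℝ} (hw : MemLp w p μ) (s : SimpleFunc E NNReal) :
    MemLp (fun x => (s x : ℝ) * w x) p μ := by
  obtain ⟨C, hC⟩ := (s.map fun c : NNReal => (c : ℝ)).exists_forall_norm_le
  refine hw.of_le_mul (c := C) ?_ (Eventually.of_forall fun x => ?_)
  · exact (s.map fun c : NNReal => (c : ℝ)).aestronglyMeasurable.mul hw.1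
  · rw [norm_mul]
    gcongr
    exact hC x

/-- A density on weighted indicators represents the functional on weighted simple functions. -/
theorem lintegral_density_simpleFunc {ψ : StrongDual ℝ (Lp ℝ p μ)}
    (hψ : ∀ f, 0 ≤ f → 0 ≤ ψ f) {w : E → ℝ} (hw : MemLp w p μ) (hw0 : ∀ x, 0 ≤ w x)
    {k : E → ENNReal} (hk : Measurable k)
    (h : ∀ (A : Set E) (hA : MeasurableSet A),
      ∫⁻ x in A, k x ∂μ = ENNReal.ofReal (ψ ((hw.indicator hA).toLp _)))
    (s : SimpleFunc E NNReal) :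
    ∫⁻ x, k x * s x ∂μ = ENNReal.ofReal (ψ ((memLp_simpleFunc_mul hw s).toLp _)) := by
  induction s using SimpleFunc.induction with
  | @const c A hA =>
    have h1 : (memLp_simpleFunc_mul hw (SimpleFunc.piecewise A hA (SimpleFunc.const _ c)
        (SimpleFunc.const _ 0))).toLp _ = (c : ℝ) • (hw.indicator hA).toLp _ := by
      rw [← MemLp.toLp_const_smul]
      refine MemLp.toLp_congr _ _ (Eventually.of_forall fun x => ?_)
      by_cases hx : x ∈ A <;> simp [hx]
    rw [h1, map_smul, smul_eq_mul, ENNReal.ofReal_mul c.coe_nonneg, ← h A hA,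
      ENNReal.ofReal_coe_nnreal, ← lintegral_const_mul _ hk, ← lintegral_indicator hA]
    congr 1
    ext x
    by_cases hx : x ∈ A <;> simp [hx, mul_comm]
  | add hst hs ht =>
    rename_i s t
    have h1 : (memLp_simpleFunc_mul hw (s + t)).toLp _ =
        (memLp_simpleFunc_mul hw s).toLp _ + (memLp_simpleFunc_mul hw t).toLp _ := by
      rw [← MemLp.toLp_add]
      refine MemLp.toLp_congr _ _ (Eventually.of_forall fun x => ?_)
      simp [add_mul]
    have hpos : ∀ s : SimpleFunc E NNReal, 0 ≤ ψ ((memLp_simpleFunc_mul hw s).toLp _) :=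
      fun s => hψ _ (toLp_nonneg _
        (Eventually.of_forall fun x => mul_nonneg (s x).coe_nonneg (hw0 x)))
    rw [h1, map_add, ENNReal.ofReal_add (hpos s) (hpos t), ← hs, ← ht,
      ← lintegral_add_left (f := fun x => k x * s x) (hk.mul s.measurable.coe_nnreal_ennreal)]
    refine lintegral_congr fun x => ?_
    simp [mul_add]

/-- A positive functional on `L^p` is given on nonnegative functions by a density. -/
theorem exists_density_of_positive_functional [SigmaFinite μ] (hp : p ≠ ⊤)
    (ψ : StrongDual ℝ (Lp ℝ p μ)) (hψ : ∀ f, 0 ≤ f → 0 ≤ ψ f) :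
    ∃ g : E → ENNReal, Measurable g ∧ (∀ᵐ x ∂μ, g x < ⊤) ∧
      ∀ f : Lp ℝ p μ, 0 ≤ f → ∫⁻ x, g x * ENNReal.ofReal (f x) ∂μ = ENNReal.ofReal (ψ f) := by
  have hp0 : p ≠ 0 := (zero_lt_one.trans_le Fact.out).ne'
  have hppos : 0 < p.toReal := ENNReal.toReal_pos hp0 hp
  -- σ-finiteness supplies a positive integrable v; w = v^(1/p) is then a positive weight in L^p,
  -- and the density sought is k/w.
  obtain ⟨v, hv0, hvm, hvint⟩ := exists_pos_lintegral_lt_of_sigmaFinite μ one_ne_zero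
  set w : E → ℝ := fun x => (v x : ℝ) ^ (1 / p.toReal) with hw_def
  have hwpos : ∀ x, 0 < w x := fun x => Real.rpow_pos_of_pos (by exact_mod_cast hv0 x) _
  have hwm : Measurable w := hvm.coe_nnreal_real.pow_const _
  have hw : MemLp w p μ := by
    refine ⟨hwm.aestronglyMeasurable, ?_⟩
    rw [eLpNorm_lt_top_iff_lintegral_rpow_enorm_lt_top hp0 hp]
    refine lt_of_eq_of_lt (lintegral_congr fun x => ?_) (hvint.trans ENNReal.one_lt_top)
    rw [Real.enorm_eq_ofReal (hwpos x).le, ENNReal.ofReal_rpow_of_nonneg (hwpos x).le hppos.le,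
      hw_def, ← Real.rpow_mul (v x).coe_nonneg, one_div_mul_cancel hppos.ne', Real.rpow_one,
      ENNReal.ofReal_coe_nnreal]
  have hw0 : ∀ x, 0 ≤ w x := fun x => (hwpos x).le
  obtain ⟨k, hkm, hktop, hk⟩ := exists_density_indicator hp ψ hψ hw hw0
  refine ⟨fun x => k x * ENNReal.ofReal (w x)⁻¹, hkm.mul hwm.inv.ennreal_ofReal, ?_,
    fun f hf => ?_⟩
  · filter_upwards [hktop] with x hx
    exact ENNReal.mul_lt_top hx ENNReal.ofReal_lt_top
  -- Simple functions increasing to f/w, multiplied by w, tend to f in L^p by domination; on the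
  -- density side monotone convergence applies.
  set h : E → ENNReal := fun x => ENNReal.ofReal (f x / w x) with hh
  have hhm : Measurable h := ((Lp.stronglyMeasurable f).measurable.div hwm).ennreal_ofReal
  set s : ℕ → SimpleFunc E NNReal := fun n => (SimpleFunc.eapprox h n).map ENNReal.toNNReal with hs
  have hsx : ∀ n x, ((s n x : NNReal) : ENNReal) = SimpleFunc.eapprox h n x := fun n x => by
    simp only [hs, SimpleFunc.map_apply]
    exact ENNReal.coe_toNNReal (SimpleFunc.eapprox_lt_top h n x).ne
  have hfnn : ∀ᵐ x ∂μ, 0 ≤ f x := (Lp.coeFn_nonneg f).2 hf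
  have hsle : ∀ n x, 0 ≤ f x → (s n x : ℝ) * w x ≤ f x := by
    intro n x hx
    rw [← le_div_iff₀ (hwpos x), ← ENNReal.ofReal_le_ofReal_iff (div_nonneg hx (hw0 x)),
      ENNReal.ofReal_coe_nnreal, hsx]
    have := le_iSup (fun n => (SimpleFunc.eapprox h n : E → ENNReal) x) n
    rwa [SimpleFunc.iSup_eapprox_apply hhm] at this
  have hslim : ∀ x, 0 ≤ f x → Tendsto (fun n => (s n x : ℝ) * w x) atTop (𝓝 (f x)) := by
    intro x hx
    have h1 := SimpleFunc.tendsto_eapprox hhm x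
    have h2 := (ENNReal.tendsto_toReal (ENNReal.ofReal_ne_top)).comp h1
    rw [ENNReal.toReal_ofReal (div_nonneg hx (hw0 x))] at h2
    have h3 := h2.mul_const (w x)
    rw [div_mul_cancel₀ _ (hwpos x).ne'] at h3
    exact h3
  have hψlim : Tendsto (fun n => ENNReal.ofReal (ψ ((memLp_simpleFunc_mul hw (s n)).toLp _))) atTop
      (𝓝 (ENNReal.ofReal (ψ f))) := by
    refine (ENNReal.continuous_ofReal.tendsto _).comp ((ψ.continuous.tendsto _).comp
      (tendsto_Lp_of_dominated hp (fun n => ?_) (fun n => ?_) ?_))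
    · filter_upwards [(memLp_simpleFunc_mul hw (s n)).coeFn_toLp] with x h1
      rw [h1]; exact mul_nonneg (s n x).coe_nonneg (hw0 x)
    · filter_upwards [(memLp_simpleFunc_mul hw (s n)).coeFn_toLp, hfnn] with x h1 h2
      rw [h1]; exact hsle n x h2
    · have h1 := ae_all_iff.2 fun n => (memLp_simpleFunc_mul hw (s n)).coeFn_toLp
      filter_upwards [h1, hfnn] with x h1 h2
      simp_rw [h1]
      exact hslim x h2
  have hlint : Tendsto (fun n => ∫⁻ x, k x * s n x ∂μ) atTop (𝓝 (∫⁻ x, k x * h x ∂μ)) := by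
    refine lintegral_tendsto_of_tendsto_of_monotone
      (fun n => (hkm.mul (s n).measurable.coe_nnreal_ennreal).aemeasurable) ?_ ?_
    · refine Eventually.of_forall fun x n m hnm => ?_
      simp only [hsx]
      gcongr
      exact SimpleFunc.monotone_eapprox h hnm x
    · filter_upwards [hktop] with x hx
      simp only [hsx]
      exact ENNReal.Tendsto.const_mul (SimpleFunc.tendsto_eapprox hhm x) (Or.inr hx.ne)
  have heq := tendsto_nhds_unique (hψlim.congr fun n =>
    (lintegral_density_simpleFunc hψ hw hw0 hkm hk (s n)).symm) hlint
  rw [heq]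
  refine lintegral_congr fun x => ?_
  simp only [hh]
  rw [mul_assoc, div_eq_inv_mul, ENNReal.ofReal_mul (inv_nonneg.2 (hw0 x))]

/-- The density of a bounded functional on `L^1` is essentially bounded. -/
theorem ae_le_opNorm_of_density [SigmaFinite μ] (ψ : StrongDual ℝ (Lp ℝ 1 μ)) {g : E → ENNReal}
    (hg : Measurable g)
    (h : ∀ f : Lp ℝ 1 μ, 0 ≤ f → ∫⁻ x, g x * ENNReal.ofReal (f x) ∂μ = ENNReal.ofReal (ψ f)) :
    ∀ᵐ x ∂μ, g x ≤ ENNReal.ofReal ‖ψ‖ := by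
  refine ae_le_of_forall_setLIntegral_le_of_sigmaFinite hg fun A hA hμA => ?_
  have hf : MemLp (A.indicator fun _ => (1 : ℝ)) 1 μ :=
    memLp_indicator_const 1 hA 1 (Or.inr hμA.ne)
  have h1 := h (hf.toLp _) (toLp_nonneg hf
    (Eventually.of_forall (Set.indicator_nonneg fun _ _ => zero_le_one)))
  have h2 : ∫⁻ x, g x * ENNReal.ofReal (hf.toLp _ x) ∂μ = ∫⁻ x in A, g x ∂μ := by
    rw [← lintegral_indicator hA]
    refine lintegral_congr_ae ?_
    filter_upwards [hf.coeFn_toLp] with x hx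
    rw [hx]
    by_cases hxA : x ∈ A <;> simp [hxA]
  have h3 : ‖hf.toLp _‖ = (μ A).toReal := by
    rw [Lp.norm_toLp, eLpNorm_indicator_const hA one_ne_zero ENNReal.one_ne_top]
    simp
  rw [← h2, h1, setLIntegral_const]
  calc ENNReal.ofReal (ψ (hf.toLp _)) ≤ ENNReal.ofReal (‖ψ‖ * ‖hf.toLp _‖) :=
        ENNReal.ofReal_le_ofReal ((le_abs_self _).trans (ψ.le_opNorm _))
    _ = ENNReal.ofReal ‖ψ‖ * μ A := by
        rw [h3, ENNReal.ofReal_mul (norm_nonneg _), ENNReal.ofReal_toReal hμA.ne]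

/-- The density of a bounded functional on `L^p`, `1 < p < ∞`, is in `L^q`. -/
theorem lintegral_rpow_le_of_density [SigmaFinite μ] {P Q : ℝ} (hPQ : P.HolderConjugate Q)
    (hp : p.toReal = P) (ψ : StrongDual ℝ (Lp ℝ p μ)) {g : E → ENNReal} (hg : Measurable g)
    (h : ∀ f : Lp ℝ p μ, 0 ≤ f → ∫⁻ x, g x * ENNReal.ofReal (f x) ∂μ = ENNReal.ofReal (ψ f)) :
    ∫⁻ x, g x ^ Q ∂μ ≤ ENNReal.ofReal ‖ψ‖ ^ Q := by
  have hP := hPQ.pos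
  have hQ := hPQ.symm.pos
  have hQ1 := hPQ.symm.sub_one_pos
  have hptop : p ≠ ⊤ := by rintro rfl; simp at hp; linarith
  have hp0 : p ≠ 0 := by rintro rfl; simp at hp; linarith
  -- Truncating in height and support makes ∫ f^Q finite, so that it may be divided out; monotone
  -- convergence then recovers g.
  set f : ℕ → E → ENNReal := fun n => (spanningSets μ n).indicator fun x => min (g x) n with hf
  have hfm : ∀ n, Measurable (f n) := fun n =>
    (hg.min measurable_const).indicator (measurableSet_spanningSets μ n)
  have hfg : ∀ n x, f n x ≤ g x := fun n x => by
    by_cases hx : x ∈ spanningSets μ n <;> simp [hf, hx]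
  have hfn : ∀ n x, f n x ≤ n := fun n x => by
    by_cases hx : x ∈ spanningSets μ n <;> simp [hf, hx]
  have hftop : ∀ n x, f n x ≠ ⊤ := fun n x =>
    ne_top_of_le_ne_top (ENNReal.natCast_ne_top n) (hfn n x)
  have hbound : ∀ n, ∫⁻ x, f n x ^ Q ∂μ ≤ ENNReal.ofReal ‖ψ‖ ^ Q := by
    intro n
    have hItop : ∫⁻ x, f n x ^ Q ∂μ ≠ ⊤ := by
      have h1 : ∀ x, f n x ^ Q ≤ (spanningSets μ n).indicator (fun _ => (n : ENNReal) ^ Q) x := by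
        intro x
        by_cases hx : x ∈ spanningSets μ n
        · rw [Set.indicator_of_mem hx]
          exact ENNReal.rpow_le_rpow (hfn n x) hQ.le
        · simp [hf, hx, hQ]
      refine ne_top_of_le_ne_top ?_ (lintegral_mono h1)
      rw [lintegral_indicator_const (measurableSet_spanningSets μ n)]
      exact ENNReal.mul_ne_top (ENNReal.rpow_ne_top_of_nonneg hQ.le (ENNReal.natCast_ne_top n))
        (measure_spanningSets_lt_top μ n).ne
    -- The extremal function of Hölder's inequality: F^P = f^Q, which yields I ≤ ‖ψ‖ I^(1/P) for I =
    -- ∫ f^Q.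
    set F : E → ℝ := fun x => (f n x ^ (Q - 1)).toReal with hF
    have hFof : ∀ x, ENNReal.ofReal (F x) = f n x ^ (Q - 1) := fun x =>
      ENNReal.ofReal_toReal (ENNReal.rpow_ne_top_of_nonneg hQ1.le (hftop n x))
    have hFnorm : eLpNorm F p μ = (∫⁻ x, f n x ^ Q ∂μ) ^ (1 / P) := by
      rw [eLpNorm_eq_lintegral_rpow_enorm_toReal hp0 hptop, hp]
      congr 1
      refine lintegral_congr fun x => ?_
      rw [Real.enorm_eq_ofReal ENNReal.toReal_nonneg, hFof, ← ENNReal.rpow_mul,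
        hPQ.symm.sub_one_mul_conj]
    have hFmem : MemLp F p μ := by
      refine ⟨((hfm n).pow_const _).ennreal_toReal.aestronglyMeasurable, ?_⟩
      rw [hFnorm]
      exact ENNReal.rpow_lt_top_of_nonneg (by positivity) hItop
    have h1 := h (hFmem.toLp F) (toLp_nonneg hFmem
      (Eventually.of_forall fun x => ENNReal.toReal_nonneg))
    have h2 : ∫⁻ x, f n x ^ Q ∂μ ≤ ENNReal.ofReal ‖ψ‖ * (∫⁻ x, f n x ^ Q ∂μ) ^ (1 / P) := by
      calc ∫⁻ x, f n x ^ Q ∂μ ≤ ∫⁻ x, g x * ENNReal.ofReal (hFmem.toLp F x) ∂μ := by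
            refine lintegral_mono_ae ?_
            filter_upwards [hFmem.coeFn_toLp] with x hx
            rw [hx, hFof]
            calc f n x ^ Q = f n x ^ (1 + (Q - 1)) := by congr 1; ring
              _ = f n x * f n x ^ (Q - 1) := by
                rw [ENNReal.rpow_add_of_nonneg _ _ zero_le_one hQ1.le, ENNReal.rpow_one]
              _ ≤ g x * f n x ^ (Q - 1) := by gcongr; exact hfg n x
        _ = ENNReal.ofReal (ψ (hFmem.toLp F)) := h1
        _ ≤ ENNReal.ofReal (‖ψ‖ * ‖hFmem.toLp F‖) :=
            ENNReal.ofReal_le_ofReal ((le_abs_self _).trans (ψ.le_opNorm _))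
        _ = ENNReal.ofReal ‖ψ‖ * (∫⁻ x, f n x ^ Q ∂μ) ^ (1 / P) := by
            rw [ENNReal.ofReal_mul (norm_nonneg _), Lp.norm_toLp, hFnorm,
              ENNReal.ofReal_toReal (ENNReal.rpow_ne_top_of_nonneg (by positivity) hItop)]
    set I := ∫⁻ x, f n x ^ Q ∂μ with hI
    rcases eq_or_ne I 0 with h0 | h0
    · rw [h0]; exact zero_le
    · have hne0 : I ^ (1 / P) ≠ 0 := by
        rw [Ne, ENNReal.rpow_eq_zero_iff]
        rintro (⟨h3, -⟩ | ⟨h3, -⟩)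
        · exact h0 h3
        · exact hItop h3
      have hnetop : I ^ (1 / P) ≠ ⊤ := ENNReal.rpow_ne_top_of_nonneg (by positivity) hItop
      have h3 : I ^ (1 / Q) ≤ ENNReal.ofReal ‖ψ‖ := by
        have h4 : I = I ^ (1 / Q) * I ^ (1 / P) := by
          rw [← ENNReal.rpow_add _ _ h0 hItop, one_div, one_div, hPQ.symm.inv_add_inv_eq_one,
            ENNReal.rpow_one]
        exact (ENNReal.mul_le_mul_iff_left hne0 hnetop).1 (h4.symm.trans_le h2)
      have h5 := ENNReal.rpow_le_rpow h3 hQ.le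
      rwa [← ENNReal.rpow_mul, one_div_mul_cancel hQ.ne', ENNReal.rpow_one] at h5
  have hlim : Tendsto (fun n => ∫⁻ x, f n x ^ Q ∂μ) atTop (𝓝 (∫⁻ x, g x ^ Q ∂μ)) := by
    refine lintegral_tendsto_of_tendsto_of_monotone
      (fun n => ((hfm n).pow_const _).aemeasurable) (Eventually.of_forall fun x n m hnm => ?_)
      (Eventually.of_forall fun x => ?_)
    · refine ENNReal.rpow_le_rpow ?_ hQ.le
      by_cases hx : x ∈ spanningSets μ n
      · have hx' := monotone_spanningSets μ hnm hx
        simp only [hf, Set.indicator_of_mem hx, Set.indicator_of_mem hx']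
        gcongr
      · simp [hf, hx]
    · refine ((ENNReal.continuous_rpow_const (y := Q)).tendsto _).comp ?_
      have h1 : Tendsto (fun n : ℕ => min (g x) (n : ENNReal)) atTop (𝓝 (min (g x) ⊤)) :=
        tendsto_const_nhds.min ENNReal.tendsto_nat_nhds_top
      rw [min_top_right] at h1
      refine h1.congr' ?_
      have hx : x ∈ ⋃ i, spanningSets μ i := by rw [iUnion_spanningSets]; trivial
      obtain ⟨i, hi⟩ := Set.mem_iUnion.1 hx
      filter_upwards [eventually_ge_atTop i] with n hn
      simp only [hf, Set.indicator_of_mem (monotone_spanningSets μ hn hi)]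
  exact le_of_tendsto' hlim hbound

/-- **Riesz representation** of positive functionals on `L^p`, `1 ≤ p < ∞`. -/
theorem exists_Lp_conjExponent_of_positive_functional [SigmaFinite μ] (hp : p ≠ ⊤)
    (ψ : StrongDual ℝ (Lp ℝ p μ)) (hψ : ∀ f, 0 ≤ f → 0 ≤ ψ f) :
    ∃ g : Lp ℝ p.conjExponent μ, 0 ≤ g ∧ ∀ f : Lp ℝ p μ,
      Integrable (fun x => g x * f x) μ ∧ ψ f = ∫ x, g x * f x ∂μ := by
  obtain ⟨g, hgm, hgtop, hg⟩ := exists_density_of_positive_functional hp ψ hψ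
  have hmem : MemLp (fun x => (g x).toReal) p.conjExponent μ := by
    rcases eq_or_ne p 1 with rfl | hp1
    · have h1 := ae_le_opNorm_of_density ψ hgm hg
      have h2 : ENNReal.conjExponent 1 = ⊤ := by simp [ENNReal.conjExponent]
      rw [h2]
      refine memLp_top_of_bound hgm.ennreal_toReal.aestronglyMeasurable ‖ψ‖ ?_
      filter_upwards [h1] with x hx
      rw [Real.norm_of_nonneg ENNReal.toReal_nonneg]
      exact ENNReal.toReal_le_of_le_ofReal (norm_nonneg _) hx
    · have h1p : 1 < p := lt_of_le_of_ne Fact.out hp1.symm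
      have h1P : 1 < p.toReal := by
        rw [← ENNReal.toReal_one]
        exact (ENNReal.toReal_lt_toReal ENNReal.one_ne_top hp).2 h1p
      have hPQ : p.toReal.HolderConjugate p.conjExponent.toReal :=
        ENNReal.HolderConjugate.toReal h1P
      have h1 := lintegral_rpow_le_of_density hPQ rfl ψ hgm hg
      have hq := ENNReal.toReal_pos_iff.1 hPQ.symm.pos
      refine ⟨hgm.ennreal_toReal.aestronglyMeasurable, ?_⟩
      rw [eLpNorm_lt_top_iff_lintegral_rpow_enorm_lt_top hq.1.ne' hq.2.ne]
      refine lt_of_eq_of_lt (lintegral_congr_ae ?_) (h1.trans_lt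
        (ENNReal.rpow_lt_top_of_nonneg hPQ.symm.nonneg ENNReal.ofReal_ne_top))
      filter_upwards [hgtop] with x hx
      rw [Real.enorm_eq_ofReal ENNReal.toReal_nonneg, ENNReal.ofReal_toReal hx.ne]
  have hint : ∀ f : Lp ℝ p μ, Integrable (fun x => hmem.toLp _ x * f x) μ := fun f =>
    (Lp.memLp (hmem.toLp _)).integrable_mul (Lp.memLp f)
  have hpos : ∀ f : Lp ℝ p μ, 0 ≤ f → ψ f = ∫ x, hmem.toLp _ x * f x ∂μ := by
    intro f hf
    have hf0 := (Lp.coeFn_nonneg f).2 hf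
    rw [integral_eq_lintegral_of_nonneg_ae _ (hint f).1, ← ENNReal.toReal_ofReal (hψ f hf),
      ← hg f hf]
    · congr 1
      refine lintegral_congr_ae ?_
      filter_upwards [hmem.coeFn_toLp, hgtop] with x h1 h2
      rw [h1, ENNReal.ofReal_mul ENNReal.toReal_nonneg, ENNReal.ofReal_toReal h2.ne]
    · filter_upwards [hmem.coeFn_toLp, hf0] with x h1 h2
      rw [h1]
      exact mul_nonneg ENNReal.toReal_nonneg h2
  refine ⟨hmem.toLp _, toLp_nonneg hmem (Eventually.of_forall fun x => ENNReal.toReal_nonneg),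
    fun f => ⟨hint f, ?_⟩⟩
  conv_lhs => rw [← posPart_sub_negPart f]
  rw [map_sub, hpos _ (posPart_nonneg f), hpos _ (negPart_nonneg f),
    ← integral_sub (hint _) (hint _)]
  refine integral_congr_ae ?_
  filter_upwards [Lp.coeFn_sub f⁺ f⁻] with x hx
  have : f x = f⁺ x - f⁻ x := by
    conv_lhs => rw [← posPart_sub_negPart f]
    exact hx
  rw [this]; ring

end RieszRepresentation

noncomputable section

/-! ### Simplicity, peripheral eigenvalues and decay. -/

section PerronFrobenius

variable {E : Type*} [MeasurableSpace E] {μ : Measure E} {p : ENNReal} [Fact (1 ≤ p)]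

omit [Fact (1 ≤ p)] in
theorem StrictlyPos.nonneg {f : Lp ℝ p μ} (hf : StrictlyPos f) : 0 ≤ f :=
  (Lp.coeFn_nonneg f).1 (hf.mono fun _ hx => hx.le)

theorem abs_ne_zero_of_ne_zero {f : Lp ℝ p μ} (hf : f ≠ 0) : |f| ≠ 0 := fun h =>
  hf (by rw [← norm_eq_zero, ← norm_abs_eq_norm, h, norm_zero])

theorem IsStrictlyPositiveOp.isPositiveOp {V : Lp ℝ p μ →L[ℝ] Lp ℝ p μ}
    (hV : IsStrictlyPositiveOp V) : IsPositiveOp V := by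
  intro f hf
  rcases eq_or_ne f 0 with rfl | h0
  · rw [map_zero]
  · exact (hV f hf h0).nonneg

/-- A functional which is positive on nonzero nonnegative functions has an almost everywhere
positive density. -/
theorem strictlyPos_density [SigmaFinite μ] {ψ : StrongDual ℝ (Lp ℝ p μ)}
    (hψ : ∀ f, 0 ≤ f → f ≠ 0 → 0 < ψ f) {q : ENNReal} {g : Lp ℝ q μ}
    (hg : ∀ f : Lp ℝ p μ, ψ f = ∫ x, g x * f x ∂μ) : StrictlyPos g := by
  have hgm : Measurable g := (Lp.stronglyMeasurable g).measurable
  by_contra hcon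
  have hA : MeasurableSet {x | ¬ 0 < g x} := (measurableSet_lt measurable_const hgm).compl
  have hμA : 0 < μ {x | ¬ 0 < g x} := pos_iff_ne_zero.2 hcon
  -- Finite measure is needed for the indicator to be a test function in L^p.
  obtain ⟨t, ht, htA, ht0, httop⟩ := Measure.exists_subset_measure_lt_top hA hμA
  have hf : MemLp (t.indicator fun _ => (1 : ℝ)) p μ :=
    memLp_indicator_const p ht 1 (Or.inr httop.ne)
  have h1 : 0 < ψ (hf.toLp _) := by
    refine hψ _ (toLp_nonneg hf
      (Eventually.of_forall (Set.indicator_nonneg fun _ _ => zero_le_one))) fun h0 => ?_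
    have h2 := hf.coeFn_toLp
    rw [h0] at h2
    refine ht0.ne' (measure_mono_null (fun x hx => ?_) (h2.symm.trans (Lp.coeFn_zero ℝ p μ)))
    simpa using hx
  rw [hg] at h1
  refine absurd h1 (not_lt.2 (integral_nonpos_of_ae ?_))
  filter_upwards [hf.coeFn_toLp] with x hx
  rw [hx]
  by_cases hxt : x ∈ t
  · have := htA hxt
    simpa [hxt] using this
  · simp [hxt]

/-- A nonzero positive functional given by a density is positive on strictly positive
functions. -/
theorem functional_pos_of_strictlyPos {ψ : StrongDual ℝ (Lp ℝ p μ)} (hψ0 : ψ ≠ 0)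
    {q : ENNReal} {g : Lp ℝ q μ} (hg0 : 0 ≤ g)
    (hg : ∀ f : Lp ℝ p μ, Integrable (fun x => g x * f x) μ ∧ ψ f = ∫ x, g x * f x ∂μ)
    {h : Lp ℝ p μ} (hh : StrictlyPos h) : 0 < ψ h := by
  have hnn : 0 ≤ᵐ[μ] fun x => g x * h x := by
    filter_upwards [(Lp.coeFn_nonneg g).2 hg0, hh] with x h1 h2
    exact mul_nonneg h1 h2.le
  rw [(hg h).2]
  -- If ∫ gh = 0 with h > 0, then g = 0 almost everywhere and ψ vanishes.
  refine (integral_nonneg_of_ae hnn).lt_of_ne' fun h0 => hψ0 ?_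
  rw [integral_eq_zero_iff_of_nonneg_ae hnn (hg h).1] at h0
  ext f
  rw [(hg f).2, zero_apply]
  refine integral_eq_zero_of_ae ?_
  filter_upwards [h0, hh] with x h1 h2
  have : g x = 0 := by simpa [h2.ne'] using h1
  simp [this]

/-- A strictly positive operator `V` with a positive fixed vector `f₀` and an invariant strictly
positive functional `φ`, `φ f₀ = 1`. -/
structure IsPerronPair (V : Lp ℝ p μ →L[ℝ] Lp ℝ p μ) (f₀ : Lp ℝ p μ)
    (φ : StrongDual ℝ (Lp ℝ p μ)) : Prop where
  strict : IsStrictlyPositiveOp V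
  apply_fixed : V f₀ = f₀
  invariant : ∀ f, φ (V f) = φ f
  normalized : φ f₀ = 1
  pos : ∀ f, 0 ≤ f → f ≠ 0 → 0 < φ f
  pos_of_strictlyPos : ∀ f, StrictlyPos f → 0 < φ f

/-- Strictness comes from the fixed-point equations: f₀ = V f₀, and ψ(f) = ψ(Vf) with Vf positive
almost everywhere. A density for ψ first gives ψ > 0 on such functions; only then is the density of
the normalized functional seen to be strictly positive. -/
theorem exists_isPerronPair [SigmaFinite μ] (hp : p ≠ ⊤) {V : Lp ℝ p μ →L[ℝ] Lp ℝ p μ}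
    (hV : IsStrictlyPositiveOp V) (hr : spectralRadius ℂ (complexify V) = 1)
    (hess : EssInvertible (1 - complexify V)) :
    ∃ f₀ φ, IsPerronPair V f₀ φ ∧ StrictlyPos f₀ ∧ StrictlyPosDual φ := by
  have hVpos := hV.isPositiveOp
  obtain ⟨f₀, hf₀, hf₀', hVf₀⟩ := hVpos.exists_eigenvector hr hess
  have hf₀s : StrictlyPos f₀ := hVf₀ ▸ hV f₀ hf₀ hf₀'
  obtain ⟨ψ, hψ, hψ0, hψV⟩ := hVpos.exists_dual_eigenvector hr hess hf₀ hf₀' hVf₀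
  have hψs : ∀ h, StrictlyPos h → 0 < ψ h := by
    obtain ⟨g, hg0, hg⟩ := exists_Lp_conjExponent_of_positive_functional hp ψ hψ
    exact fun h hh => functional_pos_of_strictlyPos hψ0 hg0 hg hh
  have hψf₀ : 0 < ψ f₀ := hψs f₀ hf₀s
  have hpos : ∀ f, 0 ≤ f → f ≠ 0 → 0 < ((ψ f₀)⁻¹ • ψ) f := fun f hf hf0 => by
    rw [smul_apply, ← hψV f]
    exact mul_pos (inv_pos.2 hψf₀) (hψs _ (hV f hf hf0))
  refine ⟨f₀, (ψ f₀)⁻¹ • ψ, ⟨hV, hVf₀, fun f => ?_, ?_, hpos, fun f hf => ?_⟩, hf₀s, ?_⟩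
  · rw [smul_apply, smul_apply, hψV]
  · exact inv_mul_cancel₀ hψf₀.ne'
  · exact mul_pos (inv_pos.2 hψf₀) (hψs f hf)
  · obtain ⟨g, -, hg⟩ := exists_Lp_conjExponent_of_positive_functional hp ((ψ f₀)⁻¹ • ψ)
      fun f hf => mul_nonneg (inv_pos.2 hψf₀).le (hψ f hf)
    exact ⟨g, strictlyPos_density hpos fun f => (hg f).2, fun f => (hg f).2⟩

namespace IsPerronPair

variable {V : Lp ℝ p μ →L[ℝ] Lp ℝ p μ} {f₀ : Lp ℝ p μ} {φ : StrongDual ℝ (Lp ℝ p μ)}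

/-- `V` strictly contracts the `φ`-mass of functions of mean zero. -/
theorem apply_abs_lt (h : IsPerronPair V f₀ φ) {a : Lp ℝ p μ} (ha : φ a = 0) (ha0 : a ≠ 0) :
    φ |V a| < φ |a| := by
  have habs : 0 < φ |a| := h.pos _ (abs_nonneg a) (abs_ne_zero_of_ne_zero ha0)
  have hsub : φ a⁺ = φ a⁻ := by
    rw [← sub_eq_zero, ← map_sub, posPart_sub_negPart, ha]
  have hadd : φ |a| = φ a⁺ + φ a⁻ := by rw [← map_add, posPart_add_negPart]
  have hpos : a⁺ ≠ 0 := by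
    intro h0
    rw [hadd, ← hsub, h0, map_zero, add_zero] at habs
    exact lt_irrefl _ habs
  have hneg : a⁻ ≠ 0 := by
    intro h0
    rw [hadd, hsub, h0, map_zero, add_zero] at habs
    exact lt_irrefl _ habs
  -- Both V a⁺ and V a⁻ are positive almost everywhere, so |V a⁺ - V a⁻| < V a⁺ + V a⁻.
  have hstrict : StrictlyPos (V |a| - |V a|) := by
    have h1 : V |a| = V a⁺ + V a⁻ := by rw [← map_add, posPart_add_negPart]
    have h2 : V a = V a⁺ - V a⁻ := by rw [← map_sub, posPart_sub_negPart]
    filter_upwards [h.strict _ (posPart_nonneg a) hpos, h.strict _ (negPart_nonneg a) hneg,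
      Lp.coeFn_sub (V |a|) |V a|, Lp.coeFn_abs (V a), Lp.coeFn_add (V a⁺) (V a⁻),
      Lp.coeFn_sub (V a⁺) (V a⁻)] with x hx1 hx2 hx3 hx4 hx5 hx6
    rw [hx3, Pi.sub_apply, hx4, h1, h2, hx5, hx6, Pi.add_apply, Pi.sub_apply, sub_pos, abs_lt]
    constructor <;> linarith
  have := h.pos_of_strictlyPos _ hstrict
  rw [map_sub, h.invariant] at this
  linarith

/-- The difference f - φ(f) f₀ is a fixed vector of mean zero, which the strict contraction forbids
unless it vanishes. -/
theorem eq_smul_of_apply_eq (h : IsPerronPair V f₀ φ) {f : Lp ℝ p μ} (hf : V f = f) :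
    f = φ f • f₀ := by
  by_contra hne
  have h0 : φ (f - φ f • f₀) = 0 := by
    rw [map_sub, map_smul, h.normalized, smul_eq_mul, mul_one, sub_self]
  have h1 : V (f - φ f • f₀) = f - φ f • f₀ := by
    rw [map_sub, map_smul, h.apply_fixed, hf]
  have h2 := h.apply_abs_lt h0 (sub_ne_zero.2 hne)
  rw [h1] at h2
  exact lt_irrefl _ h2

theorem eq_zero_of_functional_abs_nonpos (h : IsPerronPair V f₀ φ) {g : Lp ℝ p μ}
    (hg : φ |g| ≤ 0) : g = 0 := by
  by_contra h0
  exact absurd (h.pos _ (abs_nonneg g) (abs_ne_zero_of_ne_zero h0)) (not_lt.2 hg)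

/-- The only eigenvalue of modulus one is `1`. -/
theorem eq_zero_of_complexify_apply_eq (h : IsPerronPair V f₀ φ) {z : ℂ} (hz : ‖z‖ = 1)
    (hz1 : z ≠ 1) {f : Lp ℂ p μ} (hf : complexify V f = z • f) : f = 0 := by
  have hz0 : z ≠ 0 := by rintro rfl; simp at hz
  have hV : ∀ w : ℂ, V (reL (w • f)) = reL ((w * z) • f) := fun w => by
    rw [← reL_complexify, map_smul, hf, smul_smul]
  -- The complex mean c of f satisfies c = zc by invariance, and z ≠ 1.
  have hmean : (⟨φ (reL f), φ (imL f)⟩ : ℂ) = 0 := by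
    have h1 : φ (reL f) = z.re * φ (reL f) - z.im * φ (imL f) := by
      conv_lhs => rw [← h.invariant, ← reL_complexify, hf, reL_smul, map_sub, map_smul, map_smul]
      rfl
    have h2 : φ (imL f) = z.re * φ (imL f) + z.im * φ (reL f) := by
      conv_lhs => rw [← h.invariant, ← imL_complexify, hf, imL_smul, map_add, map_smul, map_smul]
      rfl
    have h3 : (1 - z) * (⟨φ (reL f), φ (imL f)⟩ : ℂ) = 0 := by
      apply Complex.ext <;> simp <;> linarith
    exact (mul_eq_zero.1 h3).resolve_left (sub_ne_zero.2 hz1.symm)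
  have hre : φ (reL f) = 0 := congrArg Complex.re hmean
  have him : φ (imL f) = 0 := congrArg Complex.im hmean
  have hzero : ∀ w : ℂ, φ (reL (w • f)) = 0 := fun w => by
    rw [reL_smul, map_sub, map_smul, map_smul, hre, him, smul_zero, smul_zero, sub_zero]
  have hcont : Continuous fun w : ℂ => φ |reL (w • f)| := by
    have h1 : Continuous fun w : ℂ => reL (w • f) := by fun_prop
    exact φ.continuous.comp (h1.sup h1.neg)
  -- V carries Re(w₀z⁻¹f) to Re(w₀f). Were the former nonzero, its mass would strictly exceed the
  -- maximum; so it is zero, and the maximum is zero.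
  obtain ⟨w₀, hw₀, hmax⟩ := (isCompact_sphere (0 : ℂ) 1).exists_isMaxOn
    ⟨1, by simp⟩ hcont.continuousOn
  have hw₀n : ‖w₀‖ = 1 := by simpa using hw₀
  have hle : ∀ w : ℂ, ‖w‖ = 1 → φ |reL (w • f)| ≤ φ |reL (w₀ • f)| := fun w hw =>
    hmax (by simpa using hw)
  have hVw₀ : V (reL ((w₀ * z⁻¹) • f)) = reL (w₀ • f) := by
    rw [hV, inv_mul_cancel_right₀ hz0]
  have ha : reL ((w₀ * z⁻¹) • f) = 0 := by
    by_contra hne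
    have h1 := h.apply_abs_lt (hzero _) hne
    rw [hVw₀] at h1
    exact absurd (hle (w₀ * z⁻¹) (by rw [norm_mul, norm_inv, hz, hw₀n]; simp)) (not_le.2 h1)
  have hall : ∀ w : ℂ, ‖w‖ = 1 → reL (w • f) = 0 := fun w hw => by
    refine h.eq_zero_of_functional_abs_nonpos ((hle w hw).trans ?_)
    rw [← hVw₀, ha, map_zero, abs_zero, map_zero]
  refine ext_reL_imL ?_ ?_
  · rw [map_zero, ← hall 1 (by simp), one_smul]
  · have h1 := hall Complex.I (by simp)
    rw [reL_I_smul, neg_eq_zero] at h1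
    rw [map_zero, h1]

theorem fixed_ne_zero (h : IsPerronPair V f₀ φ) : f₀ ≠ 0 := by
  rintro rfl
  simpa using h.normalized

/-- The operator has finite rank: it factors through ℝ × ℝ. -/
theorem isCompactOperator_complexify_smulRight (φ : StrongDual ℝ (Lp ℝ p μ)) (f₀ : Lp ℝ p μ) :
    IsCompactOperator (complexify (φ.smulRight f₀)) := by
  have h1 : IsCompactOperator ((φ ∘L reL).prod (φ ∘L imL) : Lp ℂ p μ →L[ℝ] ℝ × ℝ) :=
    isCompactOperator_of_locallyCompactSpace_dom _
  have h2 : Continuous fun c : ℝ × ℝ =>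
      ofRealL (c.1 • f₀) + Complex.I • ofRealL (c.2 • f₀) := by fun_prop
  exact h1.continuous_comp h2

/-- Removing the spectral projection of the eigenvalue one leaves an operator of spectral radius
smaller than one. -/
theorem spectralRadius_deflation_lt_one (h : IsPerronPair V f₀ φ)
    (hr : spectralRadius ℂ (complexify V) = 1)
    (hess : ∀ z : ℂ, 1 ≤ ‖z‖ →
      EssInvertible (algebraMap ℂ (Lp ℂ p μ →L[ℂ] Lp ℂ p μ) z - complexify V)) :
    spectralRadius ℂ (complexify (V - φ.smulRight f₀)) < 1 := by
  refine spectralRadius_lt_one_of_essInvertible _ (fun z hz => ?_) fun z hz u hu => ?_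
  · have h1 := (hess z hz).add_compact (isCompactOperator_complexify_smulRight φ f₀)
    rwa [sub_add, ← complexify_sub] at h1
  · have hz0 : z ≠ 0 := by rintro rfl; simp at hz; linarith
    -- The deflated operator maps into ker φ, so an eigenvector for z ≠ 0 has mean zero and is an
    -- eigenvector of V as well.
    have hmean : ∀ f, φ ((V - φ.smulRight f₀) f) = 0 := fun f => by
      rw [sub_apply, ContinuousLinearMap.smulRight_apply, map_sub, map_smul, h.invariant,
        h.normalized, smul_eq_mul, mul_one, sub_self]
    have hu' : u = z⁻¹ • complexify (V - φ.smulRight f₀) u := by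
      rw [hu, inv_smul_smul₀ hz0]
    have hre : φ (reL u) = 0 := by
      rw [hu', reL_smul, reL_complexify, imL_complexify, map_sub, map_smul, map_smul, hmean, hmean]
      simp
    have him : φ (imL u) = 0 := by
      rw [hu', imL_smul, reL_complexify, imL_complexify, map_add, map_smul, map_smul, hmean, hmean]
      simp
    have hVu : complexify V u = z • u := by
      rw [← hu, complexify_sub, sub_apply, eq_comm, sub_eq_self, complexify_apply,
        ContinuousLinearMap.smulRight_apply, ContinuousLinearMap.smulRight_apply, hre, him]
      simp
    by_contra hu0
    have hspec : z ∈ spectrum ℂ (complexify V) := by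
      rintro ⟨B, hB⟩
      have h1 : (B : Lp ℂ p μ →L[ℂ] Lp ℂ p μ) u = 0 := by
        rw [hB, sub_apply, hVu, Algebra.algebraMap_eq_smul_one, smul_apply, one_apply_eq_self,
          sub_self]
      have h2 : ((↑B⁻¹ : Lp ℂ p μ →L[ℂ] Lp ℂ p μ) * B) u = u := by
        rw [Units.inv_mul, one_apply_eq_self]
      rw [mul_apply_eq_comp, h1, map_zero] at h2
      exact hu0 h2.symm
    have hz1 : ‖z‖ = 1 := by
      refine le_antisymm ?_ hz
      have h1 : (‖z‖₊ : ENNReal) ≤ 1 := hr ▸ le_iSup₂ (α := ENNReal) z hspec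
      exact_mod_cast h1
    rcases eq_or_ne z 1 with rfl | hne
    · rw [one_smul] at hVu
      have h1 : reL u = 0 := by
        rw [h.eq_smul_of_apply_eq (f := reL u) (by rw [← reL_complexify, hVu]), hre, zero_smul]
      have h2 : imL u = 0 := by
        rw [h.eq_smul_of_apply_eq (f := imL u) (by rw [← imL_complexify, hVu]), him, zero_smul]
      exact hu0 (ext_reL_imL (by rw [h1, map_zero]) (by rw [h2, map_zero]))
    · exact hu0 (h.eq_zero_of_complexify_apply_eq hz1 hne hVu)

/-- Exponential decay on the kernel of `φ`. -/
theorem exists_decay (h : IsPerronPair V f₀ φ) (hr : spectralRadius ℂ (complexify V) = 1)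
    (hess : ∀ z : ℂ, 1 ≤ ‖z‖ →
      EssInvertible (algebraMap ℂ (Lp ℂ p μ →L[ℂ] Lp ℂ p μ) z - complexify V)) :
    ∃ ζ C : ℝ, 0 < ζ ∧ ζ < 1 ∧ 1 ≤ C ∧
      ∀ (n : ℕ) (f : Lp ℝ p μ), φ f = 0 → ‖(V ^ n) f‖ ≤ C * ζ ^ n * ‖f‖ := by
  obtain ⟨ζ, hζ, hζ1⟩ := ENNReal.lt_iff_exists_nnreal_btwn.1
    (h.spectralRadius_deflation_lt_one hr hess)
  have hζ0 : (0 : ℝ) < ζ := by exact_mod_cast pos_of_gt hζ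
  rw [← ENNReal.ofReal_coe_nnreal] at hζ
  obtain ⟨C, hC1, hC⟩ := exists_norm_pow_le_of_spectralRadius_lt _ hζ0 hζ
  refine ⟨ζ, C, hζ0, by exact_mod_cast hζ1, hC1, fun n f hf => ?_⟩
  have hmean : ∀ n : ℕ, φ ((V ^ n) f) = 0 := by
    intro n
    induction n with
    | zero => exact hf
    | succ n ih => rw [pow_succ', mul_apply_eq_comp, h.invariant, ih]
  -- V preserves ker φ, where the rank-one term vanishes.
  have heq : ∀ n : ℕ, ((V - φ.smulRight f₀) ^ n) f = (V ^ n) f := by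
    intro n
    induction n with
    | zero => rfl
    | succ n ih =>
      rw [pow_succ', mul_apply_eq_comp, ih, sub_apply, ContinuousLinearMap.smulRight_apply, hmean,
        zero_smul, sub_zero, pow_succ', mul_apply_eq_comp]
  rw [← heq n]
  refine (ContinuousLinearMap.le_opNorm _ _).trans ?_
  gcongr
  refine (norm_le_norm_complexify _).trans ?_
  rw [complexify_pow]
  exact hC n

/-- An invariant functional is constant along orbits, and orbits starting in ker φ tend to zero. So
χ vanishes on ker φ, and evaluation at f₀ gives the coefficient. -/
theorem eq_smul_of_invariant (h : IsPerronPair V f₀ φ) {ζ C : ℝ} (hζ0 : 0 < ζ) (hζ1 : ζ < 1)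
    (hdecay : ∀ (n : ℕ) (f : Lp ℝ p μ), φ f = 0 → ‖(V ^ n) f‖ ≤ C * ζ ^ n * ‖f‖)
    {χ : StrongDual ℝ (Lp ℝ p μ)} (hχ : ∀ f, χ (V f) = χ f) : χ = χ f₀ • φ := by
  have hpow : ∀ (n : ℕ) f, χ ((V ^ n) f) = χ f := by
    intro n f
    induction n with
    | zero => rfl
    | succ n ih => rw [pow_succ', mul_apply_eq_comp, hχ, ih]
  have hker : ∀ f, φ f = 0 → χ f = 0 := by
    intro f hf
    have h1 : Tendsto (fun n : ℕ => (V ^ n) f) atTop (𝓝 0) := by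
      refine squeeze_zero_norm (fun n => hdecay n f hf) ?_
      simpa using ((tendsto_pow_atTop_nhds_zero_of_lt_one hζ0.le hζ1).const_mul C).mul_const ‖f‖
    have h2 := (χ.continuous.tendsto 0).comp h1
    rw [map_zero] at h2
    exact tendsto_nhds_unique (tendsto_const_nhds.congr fun n => (hpow n f).symm) h2
  ext f
  have h1 := hker (f - φ f • f₀) (by
    rw [map_sub, map_smul, h.normalized, smul_eq_mul, mul_one, sub_self])
  rw [map_sub, map_smul, sub_eq_zero] at h1
  rw [h1, smul_apply, smul_eq_mul, smul_eq_mul, mul_comm]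

end IsPerronPair

end PerronFrobenius

end

end LpOperator

/-! ### The main theorem, by normalization to spectral radius one. -/

theorem theorem2p3 {E : Type*} [MeasurableSpace E] (μ : Measure E) [SigmaFinite μ]
    (p : ENNReal) [Fact (1 ≤ p)] (hp : p ≠ ⊤)
    (U : Lp ℝ p μ →L[ℝ] Lp ℝ p μ)
    (hU : IsStrictlyPositiveOp U) (hsplit : AdmitsSplitting U) :
    ∃ (f₀ : Lp ℝ p μ) (φ₀ : StrongDual ℝ (Lp ℝ p μ)),
      (StrictlyPos f₀ ∧ StrictlyPosDual φ₀ ∧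
        normalized U f₀ = f₀ ∧ dualOp (normalized U) φ₀ = φ₀) ∧
      (LinearMap.ker (normalized U - 1).toLinearMap = Submodule.span ℝ {f₀} ∧
        LinearMap.ker (dualOp (normalized U) - 1).toLinearMap = Submodule.span ℝ {φ₀}) ∧
      peripheralPointSpectrum (normalized U) = {1} ∧
      ∃ ζ C : ℝ, 0 < ζ ∧ ζ < 1 ∧ 1 ≤ C ∧
        ∀ (n : ℕ) (f : Lp ℝ p μ), φ₀ f = 0 → ‖(normalized U ^ n) f‖ ≤ C * ζ ^ n * ‖f‖ := by
  have hr0 : 0 < specRad U := by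
    obtain ⟨W, K, -, hW, -⟩ := hsplit
    exact (norm_nonneg W).trans_lt hW
  have hr := spectralRadius_normalized hr0
  have hess := fun (z : ℂ) (hz : 1 ≤ ‖z‖) => hsplit.essInvertible hz
  have hV : IsStrictlyPositiveOp (normalized U) := fun f hf hf0 => by
    filter_upwards [hU f hf hf0, Lp.coeFn_smul (specRad U)⁻¹ (U f)] with x hx1 hx2
    have : normalized U f = (specRad U)⁻¹ • U f := rfl
    rw [this, hx2]
    exact mul_pos (inv_pos.2 hr0) hx1
  have hess1 : EssInvertible (1 - complexify (normalized U)) := by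
    simpa using hess 1 (by simp)
  obtain ⟨f₀, φ₀, h, hf₀, hφ₀⟩ := exists_isPerronPair hp hV hr hess1
  obtain ⟨ζ, C, hζ0, hζ1, hC, hdecay⟩ := h.exists_decay hr hess
  have hspecRad : specRad (normalized U) = 1 := by rw [specRad, hr, ENNReal.toReal_one]
  refine ⟨f₀, φ₀, ⟨hf₀, hφ₀, h.apply_fixed, ContinuousLinearMap.ext h.invariant⟩, ⟨?_, ?_⟩, ?_,
    ζ, C, hζ0, hζ1, hC, hdecay⟩
  · ext f
    rw [LinearMap.mem_ker, Submodule.mem_span_singleton]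
    change normalized U f - f = 0 ↔ _
    rw [sub_eq_zero]
    constructor
    · exact fun hf => ⟨φ₀ f, (h.eq_smul_of_apply_eq hf).symm⟩
    · rintro ⟨c, rfl⟩
      rw [map_smul, h.apply_fixed]
  · ext χ
    rw [LinearMap.mem_ker, Submodule.mem_span_singleton]
    change dualOp (normalized U) χ - χ = 0 ↔ _
    rw [sub_eq_zero]
    constructor
    · exact fun hχ => ⟨χ f₀, (h.eq_smul_of_invariant hζ0 hζ1 hdecay
        fun f => congrArg (fun χ' : StrongDual ℝ (Lp ℝ p μ) => χ' f) hχ).symm⟩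
    · rintro ⟨c, rfl⟩
      rw [map_smul]
      exact congrArg (c • ·) (ContinuousLinearMap.ext h.invariant)
  · ext z
    constructor
    · rintro ⟨⟨f, hf0, hf⟩, hz⟩
      rw [hspecRad] at hz
      by_contra hz1
      exact hf0 (h.eq_zero_of_complexify_apply_eq hz hz1 hf)
    · rintro rfl
      refine ⟨⟨ofRealL f₀, fun h0 => h.fixed_ne_zero ?_, ?_⟩, by rw [hspecRad, norm_one]⟩
      · rw [← norm_eq_zero, ← norm_ofRealL, h0, norm_zero]
      · rw [complexify_ofRealL, h.apply_fixed, one_smul]
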